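/- Let $k\ge 1$ and $\mathbf n=(n_1,\dots,n_k)$ with all $n_i\ge 1$. For a complex Hilbert space $\mathcal H$, let $\mathbf B_{\mathbf n}(\mathcal H)$ be the regular polyball, i.e. the set of all tuples $\mathbf X=(X_1,\dots,X_k)$, $X_i=(X_{i,1},\dots,X_{i,n_i})\in B(\mathcal H)^{n_i}$, such that $\|\sum_j X_{i,j}X_{i,j}^*\|^{1/2}<1$ for each $i$, the entries of $X_s$ commute with the entries of $X_t$ whenever $s\neq t$, and the operator $(\mathrm{id}-\Phi_{X_1})\circ\cdots\circ(\mathrm{id}-\Phi_{X_k})(I)$ is positive and invertible, where $\Phi_{X_i}(Y)=\sum_j X_{i,j}YX_{i,j}^*$. Let $\mathbf B_{\mathbf n}(\mathcal H)^-$ be its norm closure. Let $\mathbb F_{m}^+$ be the free monoid on $m$ generators, $|\cdot|$ the word length, and for $\boldsymbol\alpha=(\alpha_1,\dots,\alpha_k)\in\mathbb F_{n_1}^+\times\cdots\times\mathbb F_{n_k}^+$ put $\mathbf X_{\boldsymbol\alpha}=X_{1,\alpha_1}\cdots X_{k,\alpha_k}$, where $X_{i,\alpha_i}$ is the product of the entries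 of $X_i$ along the word $\alpha_i$. For $\mathbf p\in\mathbb Z_+^k$ and $q\in\mathbb Z_+$ let $\Lambda_{\mathbf p}=\{\boldsymbol\alpha: |\alpha_i|=p_i \text{ for all } i\}$ and $\Gamma_q=\{\boldsymbol\alpha: |\alpha_1|+\cdots+|\alpha_k|=q\}$. A bounded free holomorphic function $\varphi$ on $\mathbf B_{\mathbf n}$ is a formal power series with scalar coefficients $a_{(\boldsymbol\alpha)}$ such that $\varphi(\mathbf X)=\sum_{\mathbf p\in\mathbb Z_+^k}\big(\sum_{\boldsymbol\alpha\in\Lambda_{\mathbf p}}a_{(\boldsymbol\alpha)}\mathbf X_{\boldsymbol\alpha}\big)$ converges in operator norm for every $\mathcal H$ and every $\mathbf X\in\mathbf B_{\mathbf n}(\mathcal H)$, and $\|\varphi\|_\infty:=\sup\|\varphi(\mathbf X)\|<\infty$, the supremum being over all $\mathcal H$ and all $\mathbf X\in\mathbf B_{\mathbf n}(\mathcal H)$. Let $H_0^\infty(\mathbf B_{\mathbf n})$ be the set of those with $\varphi(0)=0$. Let $K^0_{mh}(\mathbf B_{\mathbf n})$ be the largest $r\ge 0$ such that $$\sum_{\mathbf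 p\in\mathbb Z_+^k}\Big\|\sum_{\boldsymbol\alpha\in\Lambda_{\mathbf p}}a_{(\boldsymbol\alpha)}\mathbf X_{\boldsymbol\alpha}\Big\|\le\|\varphi\|_\infty$$ for all $\varphi\in H_0^\infty(\mathbf B_{\mathbf n})$, all $\mathcal H$ and all $\mathbf X\in r\,\mathbf B_{\mathbf n}(\mathcal H)^-$; and let $K^0_{h}(\mathbf B_{\mathbf n})$ be the largest $r\ge0$ such that $$\sum_{q=0}^\infty\Big\|\sum_{\boldsymbol\alpha\in\Gamma_q}a_{(\boldsymbol\alpha)}\mathbf X_{\boldsymbol\alpha}\Big\|\le\|\varphi\|_\infty$$ for all such $\varphi$, $\mathcal H$, $\mathbf X$. Then both of these largest numbers exist, and $$\sqrt{1-\left(\tfrac12\right)^{1/k}}\le K^0_{mh}(\mathbf B_{\mathbf n})\le\frac1{\sqrt2},\qquad \max\left\{\tfrac12,\sqrt{1-\left(\tfrac12\right)^{1/k}}\right\}\le K^0_{h}(\mathbf B_{\mathbf n})\le\frac1{\sqrt2}.$$ -/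

import Mathlib

universe u

noncomputable section

namespace Polyball

/-- Tuples `X = (X_1, …, X_k)` with `X_i = (X_{i,1}, …, X_{i,n_i})` of bounded operators on `H`. -/
abbrev OpTuple {k : ℕ} (n : Fin k → ℕ) (H : Type u) [NormedAddCommGroup H]
    [InnerProductSpace ℂ H] : Type u :=
  (i : Fin k) → Fin (n i) → (H →L[ℂ] H)

/-- The index set `𝔽⁺_{n_1} × ⋯ × 𝔽⁺_{n_k}`, a product of free monoids. -/
abbrev MultiWord {k : ℕ} (n : Fin k → ℕ) : Type :=
  (i : Fin k) → FreeMonoid (Fin (n i))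

section Domain

variable {k : ℕ} {n : Fin k → ℕ} {H : Type u} [NormedAddCommGroup H] [InnerProductSpace ℂ H]

/-- The monomial `X_α = X_{1,α_1} ⋯ X_{k,α_k}` (product in this order). -/
def monomial (X : OpTuple n H) (α : MultiWord n) : H →L[ℂ] H :=
  (List.ofFn fun i => FreeMonoid.lift (X i) (α i)).prod

variable [CompleteSpace H]

/-- The open noncommutative unit ball `[B(H)^m]_1`. -/
def rowBall (m : ℕ) (H : Type u) [NormedAddCommGroup H] [InnerProductSpace ℂ H]
    [CompleteSpace H] : Set (Fin m → (H →L[ℂ] H)) :=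
  {T | Real.sqrt ‖∑ j, T j * ContinuousLinearMap.adjoint (T j)‖ < 1}

/-- The map `Φ_T(Y) = ∑_j T_j Y T_j^*` on `B(H)`. -/
def cpMap {m : ℕ} (T : Fin m → (H →L[ℂ] H)) : Module.End ℂ (H →L[ℂ] H) where
  toFun Y := ∑ j, T j * Y * ContinuousLinearMap.adjoint (T j)
  map_add' Y Z := by simp [mul_add, add_mul, Finset.sum_add_distrib]
  map_smul' c Y := by simp [Finset.smul_sum]

/-- The defect mapping `Δ_X = (id - Φ_{X_1}) ∘ ⋯ ∘ (id - Φ_{X_k})`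
(multiplication in `Module.End` is composition). -/
def defect (X : OpTuple n H) : Module.End ℂ (H →L[ℂ] H) :=
  (List.ofFn fun i => 1 - cpMap (X i)).prod

/-- The polyball `P_n(H)`: each `X_i` lies in the open unit row ball, and the entries of `X_s`
commute with those of `X_t` for `s ≠ t`. -/
def polyball (n : Fin k → ℕ) (H : Type u) [NormedAddCommGroup H] [InnerProductSpace ℂ H]
    [CompleteSpace H] : Set (OpTuple n H) :=
  {X | (∀ i, X i ∈ rowBall (n i) H) ∧ ∀ s t, s ≠ t → ∀ a b, Commute (X s a) (X t b)}

/-- The regular polyball `B_n(H)`: those `X` in `P_n(H)` for which `Δ_X(I)` is positive and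
invertible. -/
def regularPolyball (n : Fin k → ℕ) (H : Type u) [NormedAddCommGroup H] [InnerProductSpace ℂ H]
    [CompleteSpace H] : Set (OpTuple n H) :=
  {X | X ∈ polyball n H ∧ (defect X 1).IsPositive ∧ IsUnit (defect X 1)}

end Domain

section Words

variable {k : ℕ} (n : Fin k → ℕ)

/-- `Λ_p = {α : |α_i| = p_i for all i}`. -/
def multiHomWords (p : Fin k → ℕ) : Set (MultiWord n) :=
  {α | ∀ i, (α i).length = p i}

/-- `Γ_q = {α : |α_1| + ⋯ + |α_k| = q}`. -/
def homWords (q : ℕ) : Set (MultiWord n) :=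
  {α | ∑ i, (α i).length = q}

theorem finite_multiHomWords (p : Fin k → ℕ) : (multiHomWords n p).Finite := by
  have h : (Set.univ.pi fun i => {w : FreeMonoid (Fin (n i)) | w.length = p i}).Finite :=
    Set.Finite.pi fun i => List.finite_length_eq (Fin (n i)) (p i)
  exact h.subset fun α hα i _ => hα i

theorem finite_homWords (q : ℕ) : (homWords n q).Finite := by
  have h : (Set.univ.pi fun i => {w : FreeMonoid (Fin (n i)) | w.length ≤ q}).Finite :=
    Set.Finite.pi fun i => List.finite_length_le (Fin (n i)) q
  refine h.subset fun α hα i _ => ?_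
  have hs : ∑ i, (α i).length = q := hα
  exact hs ▸ Finset.single_le_sum (f := fun i => (α i).length)
    (fun _ _ => Nat.zero_le _) (Finset.mem_univ i)

end Words

section FreeHolomorphic

variable {k : ℕ} {n : Fin k → ℕ}

/-- The multi-homogeneous part `∑_{α ∈ Λ_p} a_α X_α` of the formal power series `∑ a_α Z_α`. -/
def multiHomPart {H : Type u} [NormedAddCommGroup H] [InnerProductSpace ℂ H]
    (a : MultiWord n → ℂ) (X : OpTuple n H) (p : Fin k → ℕ) : H →L[ℂ] H :=
  ∑ α ∈ (finite_multiHomWords n p).toFinset, a α • monomial X α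

/-- The homogeneous part `∑_{α ∈ Γ_q} a_α X_α` of the formal power series `∑ a_α Z_α`. -/
def homPart {H : Type u} [NormedAddCommGroup H] [InnerProductSpace ℂ H]
    (a : MultiWord n → ℂ) (X : OpTuple n H) (q : ℕ) : H →L[ℂ] H :=
  ∑ α ∈ (finite_homWords n q).toFinset, a α • monomial X α

/-- The formal power series `∑ a_α Z_α` is a free holomorphic function on the abstract polyball
`B_n`: its multi-homogeneous expansion converges in operator norm at every `X` in `B_n(H)`, for
every Hilbert space `H`. -/
def IsFreeHolomorphic (a : MultiWord n → ℂ) : Prop :=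
  ∀ (H : Type u) [NormedAddCommGroup H] [InnerProductSpace ℂ H] [CompleteSpace H],
    ∀ X ∈ regularPolyball n H, Summable (multiHomPart a X)

/-- The value `φ(X)`, the sum of the multi-homogeneous expansion. -/
def eval {H : Type u} [NormedAddCommGroup H] [InnerProductSpace ℂ H]
    (a : MultiWord n → ℂ) (X : OpTuple n H) : H →L[ℂ] H :=
  ∑' p : Fin k → ℕ, multiHomPart a X p

/-- All the numbers `‖φ(X)‖`, `X ∈ B_n(H)`, `H` a Hilbert space. -/
def valueNorms (a : MultiWord n → ℂ) : Set ℝ :=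
  {x | ∃ (H : Type u) (_ : NormedAddCommGroup H) (_ : InnerProductSpace ℂ H)
    (_ : CompleteSpace H), ∃ X ∈ regularPolyball n H, ‖eval a X‖ = x}

/-- `‖φ‖_∞ = sup ‖φ(X)‖`, over all `X ∈ B_n(H)` and all Hilbert spaces `H`. -/
def supNorm (a : MultiWord n → ℂ) : ℝ :=
  sSup (valueNorms.{u} a)

/-- The Hardy space `H^∞(B_n)` of bounded free holomorphic functions on `B_n` (each given by its
coefficients). -/
def hardySpace (n : Fin k → ℕ) : Set (MultiWord n → ℂ) :=
  {a | IsFreeHolomorphic.{u} a ∧ BddAbove (valueNorms.{u} a)}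

/-- The subspace `H^∞_0(B_n) = {φ ∈ H^∞(B_n) : φ(0) = 0}`. -/
def hardySpaceZero (n : Fin k → ℕ) : Set (MultiWord n → ℂ) :=
  {a | a ∈ hardySpace.{u} n ∧
    ∀ (H : Type u) [NormedAddCommGroup H] [InnerProductSpace ℂ H] [CompleteSpace H],
      eval a (0 : OpTuple n H) = 0}

/-- The `r ≥ 0` with `∑_p ‖∑_{α ∈ Λ_p} a_α X_α‖ ≤ ‖φ‖_∞` for all `φ ∈ H^∞_0(B_n)` and all
`X ∈ r B_n(H)^-` (norm closure). The sum is taken in `[0, ∞]`. -/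
def bohrSetMultiHomZero (n : Fin k → ℕ) : Set ℝ :=
  {r | 0 ≤ r ∧ ∀ a ∈ hardySpaceZero.{u} n,
    ∀ (H : Type u) [NormedAddCommGroup H] [InnerProductSpace ℂ H] [CompleteSpace H],
      ∀ Y ∈ closure (regularPolyball n H),
        ∑' p : Fin k → ℕ, ‖multiHomPart a ((r : ℂ) • Y) p‖ₑ ≤ ENNReal.ofReal (supNorm.{u} a)}

/-- The `r ≥ 0` with `∑_q ‖∑_{α ∈ Γ_q} a_α X_α‖ ≤ ‖φ‖_∞` for all `φ ∈ H^∞_0(B_n)` and all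
`X ∈ r B_n(H)^-` (norm closure). The sum is taken in `[0, ∞]`. -/
def bohrSetHomZero (n : Fin k → ℕ) : Set ℝ :=
  {r | 0 ≤ r ∧ ∀ a ∈ hardySpaceZero.{u} n,
    ∀ (H : Type u) [NormedAddCommGroup H] [InnerProductSpace ℂ H] [CompleteSpace H],
      ∀ Y ∈ closure (regularPolyball n H),
        ∑' q : ℕ, ‖homPart a ((r : ℂ) • Y) q‖ₑ ≤ ENNReal.ofReal (supNorm.{u} a)}

/-- The Bohr radius `K^0_mh(B_n)`. -/
def bohrRadiusMultiHomZero (n : Fin k → ℕ) : ℝ :=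
  sSup (bohrSetMultiHomZero.{u} n)

/-- The Bohr radius `K^0_h(B_n)`. -/
def bohrRadiusHomZero (n : Fin k → ℕ) : ℝ :=
  sSup (bohrSetHomZero.{u} n)

end FreeHolomorphic

end Polyball

end

/-!
Both Bohr sets are closed, since a sum of norms in `[0, ∞]` is lower semicontinuous in the radius,
so each supremum is attained as soon as the sets are nonempty and bounded. Grouping by total degree
shows that every multi-homogeneous radius is also a homogeneous one. Hence it suffices to exhibit
`√(1 - 2 ^ (-1 / k))` in the multi-homogeneous set and `1 / 2` in the homogeneous set, and to bound
the homogeneous set by `1 / √2`.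

For the first radius (`mem_bohrSetMultiHomZero`), the monomials of a fixed multi-degree form a row
contraction on the closed polyball, so the part of multi-degree `p` at radius `r` has norm at most
`r ^ |p|` times the `ℓ²`-norm of its coefficients
(`norm_multiHomPart_le_of_isRowContraction`). All coefficients together have `ℓ²`-norm at most
`‖φ‖_∞` (`sum_sq_coeff_le_supNorm_sq`): evaluate `φ` at scaled creation operators and apply the
result to the vacuum vector. Truncating the Fock space to words of bounded length keeps
everything finite-dimensional, and the defect operator of the truncated shifts is still a positive
diagonal matrix. As `φ(0) = 0`, the Cauchy–Schwarz inequality over `p ≠ 0` leaves the factor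
`∑_{p ≠ 0} r ^ (2 |p|) = (1 - r ^ 2) ^ (-k) - 1`, which equals `1` for the radius in question.

For the second radius (`one_half_mem_bohrSetHomZero`), averaging `φ` over the circle
`θ ↦ exp (i θ) X`, which stays in the regular polyball, bounds each homogeneous part by `‖φ‖_∞`
(`norm_homPart_le_supNorm`), and `∑_{q ≥ 1} 2 ^ (-q) = 1`.

The upper bound (`le_of_mem_bohrSetHomZero`) comes from the function `z (b - z) / (1 - b z)` with
`b = 1 / √2`, in the single variable `Z_{1,1}`. It has supremum norm at most `1` by an elementary
case of von Neumann's inequality (`exists_hasSum_moebiusCoeff`), while the sum of the absolute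
values of its terms at `t` is `b t / (1 - b t)`, which exceeds `1` once `t > b`.
-/

noncomputable section

namespace Polyball

open Finset

/-! ### Homogeneous parts -/

section HomogeneousParts

variable {k : ℕ} {n : Fin k → ℕ} {H : Type u} [NormedAddCommGroup H] [InnerProductSpace ℂ H]

theorem prod_ofFn_smul {A : Type*} [Ring A] [Algebra ℂ A] :
    ∀ {m : ℕ} (c : Fin m → ℂ) (T : Fin m → A),
      (List.ofFn fun i => c i • T i).prod = (∏ i, c i) • (List.ofFn T).prod
  | 0, _, _ => by simp
  | m + 1, c, T => by
    rw [List.ofFn_succ, List.prod_cons, prod_ofFn_smul, List.ofFn_succ, List.prod_cons,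
      Fin.prod_univ_succ, smul_mul_smul_comm]

theorem lift_smul {A ι : Type*} [Ring A] [Algebra ℂ A] (c : ℂ) (T : ι → A) (w : FreeMonoid ι) :
    FreeMonoid.lift (c • T) w = c ^ w.length • FreeMonoid.lift T w := by
  induction w using FreeMonoid.inductionOn' with
  | one => simp
  | of_mul x xs ih =>
    rw [map_mul, map_mul, ih, FreeMonoid.length_mul, FreeMonoid.length_of, pow_add, pow_one,
      FreeMonoid.lift_eval_of, FreeMonoid.lift_eval_of, Pi.smul_apply, smul_mul_smul_comm]

theorem monomial_smul (c : ℂ) (X : OpTuple n H) (α : MultiWord n) :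
    monomial (c • X) α = c ^ (∑ i, (α i).length) • monomial X α := by
  unfold monomial
  rw [← Finset.prod_pow_eq_pow_sum, ← prod_ofFn_smul]
  simp only [Pi.smul_apply, lift_smul]

theorem monomial_one (X : OpTuple n H) : monomial X 1 = 1 := by
  unfold monomial
  simp

theorem multiHomPart_smul (a : MultiWord n → ℂ) (c : ℂ) (X : OpTuple n H) (p : Fin k → ℕ) :
    multiHomPart a (c • X) p = c ^ (∑ i, p i) • multiHomPart a X p := by
  unfold multiHomPart
  rw [Finset.smul_sum]
  refine Finset.sum_congr rfl fun α hα => ?_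
  have h : ∀ i, (α i).length = p i := (Set.Finite.mem_toFinset _).mp hα
  rw [monomial_smul, smul_comm]
  simp only [h]

theorem homPart_smul (a : MultiWord n → ℂ) (c : ℂ) (X : OpTuple n H) (q : ℕ) :
    homPart a (c • X) q = c ^ q • homPart a X q := by
  unfold homPart
  rw [Finset.smul_sum]
  refine Finset.sum_congr rfl fun α hα => ?_
  have h : ∑ i, (α i).length = q := (finite_homWords n q).mem_toFinset.mp hα
  rw [monomial_smul, smul_comm, h]

theorem homPart_eq_sum_multiHomPart (a : MultiWord n → ℂ) (X : OpTuple n H) (q : ℕ) :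
    homPart a X q = ∑ p ∈ piAntidiag univ q, multiHomPart a X p := by
  classical
  unfold homPart multiHomPart
  rw [← Finset.sum_fiberwise_of_maps_to (s := (finite_homWords n q).toFinset)
    (t := piAntidiag univ q) (g := fun α i => (α i).length)]
  · refine Finset.sum_congr rfl fun p hp => Finset.sum_congr ?_ fun _ _ => rfl
    have hp' : ∑ i, p i = q := by simpa using hp
    ext α
    simp only [mem_filter, Set.Finite.mem_toFinset, homWords, multiHomWords, Set.mem_ofPred_eq,
      funext_iff, and_iff_right_iff_imp]
    intro h
    simp only [h, hp']
  · intro α hα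
    simpa [homWords] using hα

theorem multiHomPart_zero_index (a : MultiWord n → ℂ) (X : OpTuple n H) :
    multiHomPart a X 0 = a 1 • 1 := by
  have h : (finite_multiHomWords n 0).toFinset = {1} := by
    ext α
    simp [multiHomWords, funext_iff]
  unfold multiHomPart
  rw [h, Finset.sum_singleton, monomial_one]

theorem continuous_monomial (α : MultiWord n) :
    Continuous fun X : OpTuple n H => monomial X α := by
  unfold monomial
  simp only [List.ofFn_eq_map]
  refine continuous_list_prod _ fun i _ => ?_
  simp only [FreeMonoid.lift_apply]
  exact continuous_list_prod _ fun j _ => by fun_prop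

theorem continuous_multiHomPart (a : MultiWord n → ℂ) (p : Fin k → ℕ) :
    Continuous fun X : OpTuple n H => multiHomPart a X p :=
  continuous_finsetSum _ fun α _ => (continuous_monomial α).const_smul (a α)

theorem continuous_homPart (a : MultiWord n → ℂ) (q : ℕ) :
    Continuous fun X : OpTuple n H => homPart a X q :=
  continuous_finsetSum _ fun α _ => (continuous_monomial α).const_smul (a α)

/-- The value at the zero tuple is the constant coefficient. -/
theorem eval_zero (a : MultiWord n → ℂ) : eval a (0 : OpTuple n H) = a 1 • 1 := by
  unfold eval
  rw [tsum_eq_single 0, multiHomPart_zero_index]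
  intro p hp
  have h : ∑ i, p i ≠ 0 := by
    contrapose! hp
    funext i
    simpa using (Finset.sum_eq_zero_iff.mp hp) i
  have := multiHomPart_smul a 0 (0 : OpTuple n H) p
  rwa [zero_smul, zero_pow h, zero_smul] at this

end HomogeneousParts

/-! ### The two sets of Bohr radii -/

section BohrSets

variable {k : ℕ} {n : Fin k → ℕ}

/-- Lower semicontinuity of the sum of norms. -/
theorem isClosed_tsum_enorm_le {ι E : Type*} [SeminormedAddCommGroup E] {f : ℝ → ι → E}
    (hf : ∀ i, Continuous fun r => f r i) (C : ENNReal) :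
    IsClosed {r | ∑' i, ‖f r i‖ₑ ≤ C} := by
  simp only [ENNReal.tsum_eq_iSup_sum, iSup_le_iff, Set.ofPred_forall]
  exact isClosed_iInter fun s =>
    isClosed_le (continuous_finsetSum _ fun i _ => (hf i).enorm) continuous_const

/-- Closedness makes the supremum defining the Bohr radius a maximum. -/
theorem isClosed_bohrSetMultiHomZero : IsClosed (bohrSetMultiHomZero.{u} n) := by
  unfold bohrSetMultiHomZero
  simp only [Set.ofPred_and, Set.ofPred_forall]
  refine isClosed_Ici.inter ?_
  refine isClosed_iInter fun a => isClosed_iInter fun _ => isClosed_iInter fun H =>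
    isClosed_iInter fun _ => isClosed_iInter fun _ => isClosed_iInter fun _ =>
    isClosed_iInter fun Y => isClosed_iInter fun _ => isClosed_tsum_enorm_le (fun p => ?_) _
  exact (continuous_multiHomPart a p).comp (by fun_prop)

theorem isClosed_bohrSetHomZero : IsClosed (bohrSetHomZero.{u} n) := by
  unfold bohrSetHomZero
  simp only [Set.ofPred_and, Set.ofPred_forall]
  refine isClosed_Ici.inter ?_
  refine isClosed_iInter fun a => isClosed_iInter fun _ => isClosed_iInter fun H =>
    isClosed_iInter fun _ => isClosed_iInter fun _ => isClosed_iInter fun _ =>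
    isClosed_iInter fun Y => isClosed_iInter fun _ => isClosed_tsum_enorm_le (fun p => ?_) _
  exact (continuous_homPart a p).comp (by fun_prop)

/-- Grouping the multi-homogeneous parts by total degree only decreases the sum of norms. -/
theorem tsum_enorm_homPart_le {H : Type u} [NormedAddCommGroup H] [InnerProductSpace ℂ H]
    (a : MultiWord n → ℂ) (X : OpTuple n H) :
    ∑' q, ‖homPart a X q‖ₑ ≤ ∑' p, ‖multiHomPart a X p‖ₑ := by
  rw [← ENNReal.tsum_fiberwise (fun p => ‖multiHomPart a X p‖ₑ) fun p => ∑ i, p i]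
  refine ENNReal.tsum_le_tsum fun q => ?_
  have hs : (fun p : Fin k → ℕ => ∑ i, p i) ⁻¹' {q} = ↑(piAntidiag (univ : Finset (Fin k)) q) := by
    ext p
    simp
  rw [homPart_eq_sum_multiHomPart, hs, Finset.tsum_subtype' _ fun p => ‖multiHomPart a X p‖ₑ]
  exact enorm_sum_le (piAntidiag univ q) fun p => multiHomPart a X p

theorem bohrSetMultiHomZero_subset_bohrSetHomZero :
    bohrSetMultiHomZero.{u} n ⊆ bohrSetHomZero.{u} n := fun _ hr =>
  ⟨hr.1, fun a ha H _ _ _ Y hY => (tsum_enorm_homPart_le a _).trans (hr.2 a ha H Y hY)⟩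

theorem supNorm_nonneg (a : MultiWord n → ℂ) : 0 ≤ supNorm.{u} a := by
  refine Real.sSup_nonneg ?_
  rintro _ ⟨H, _, _, _, X, _, rfl⟩
  exact norm_nonneg _

theorem norm_eval_le_supNorm {a : MultiWord n → ℂ} (ha : a ∈ hardySpace.{u} n) {H : Type u}
    [NormedAddCommGroup H] [InnerProductSpace ℂ H] [CompleteSpace H] {X : OpTuple n H}
    (hX : X ∈ regularPolyball n H) : ‖eval a X‖ ≤ supNorm.{u} a :=
  le_csSup ha.2 ⟨H, _, _, _, X, hX, rfl⟩

theorem coeff_one_eq_zero {a : MultiWord n → ℂ} (ha : a ∈ hardySpaceZero.{u} n) : a 1 = 0 := by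
  have h := ha.2 (EuclideanSpace ℂ PUnit.{u + 1})
  rw [eval_zero] at h
  simpa using h

end BohrSets

/-! ### Monomials form row contractions -/

section RowContraction

open ContinuousLinearMap

variable {H : Type u} [NormedAddCommGroup H] [InnerProductSpace ℂ H] [CompleteSpace H]

/-- A family `T` of operators is a row contraction if `∑ T_i T_i^* ≤ 1`, expressed through the
vectors `T_i^* h`. -/
def IsRowContraction {ι : Type*} (T : ι → (H →L[ℂ] H)) : Prop :=
  ∀ h : H, ∑' i, ‖adjoint (T i) h‖ₑ ^ 2 ≤ ‖h‖ₑ ^ 2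

theorem IsRowContraction.comp_equiv {ι κ : Type*} {T : ι → (H →L[ℂ] H)} (hT : IsRowContraction T)
    (e : κ ≃ ι) : IsRowContraction (T ∘ e) := fun h =>
  (e.tsum_eq fun i => ‖adjoint (T i) h‖ₑ ^ 2).trans_le (hT h)

theorem isRowContraction_one {ι : Type*} [Unique ι] :
    IsRowContraction fun _ : ι => (1 : H →L[ℂ] H) := fun h => by
  rw [tsum_fintype, Fintype.sum_unique, ← star_eq_adjoint, star_one]
  exact le_rfl

theorem IsRowContraction.mul {ι κ : Type*} {T : ι → (H →L[ℂ] H)} {S : κ → (H →L[ℂ] H)}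
    (hT : IsRowContraction T) (hS : IsRowContraction S) :
    IsRowContraction fun x : ι × κ => T x.1 * S x.2 := fun h => by
  rw [ENNReal.tsum_prod (f := fun i j => ‖adjoint (T i * S j) h‖ₑ ^ 2)]
  refine (ENNReal.tsum_le_tsum fun i => ?_).trans (hT h)
  simp only [← star_eq_adjoint, star_mul]
  exact hS _

theorem IsRowContraction.prod_ofFn : ∀ {m : ℕ} {ι : Fin m → Type} {T : ∀ i, ι i → (H →L[ℂ] H)},
    (∀ i, IsRowContraction (T i)) →
      IsRowContraction fun f : ∀ i, ι i => (List.ofFn fun i => T i (f i)).prod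
  | 0, _, _, _ => by
    simp only [List.ofFn_zero, List.prod_nil]
    exact isRowContraction_one
  | m + 1, ι, T, hT => by
    have h := ((hT 0).mul (IsRowContraction.prod_ofFn fun i : Fin m => hT i.succ)).comp_equiv
      (Fin.consEquiv ι).symm
    convert h using 2 with f
    rw [List.ofFn_succ, List.prod_cons]
    rfl

/-- The words of a fixed length in the entries of a row contraction again form a row
contraction. -/
theorem IsRowContraction.lift {ι : Type*} {T : ι → (H →L[ℂ] H)} (hT : IsRowContraction T) :
    ∀ m : ℕ, IsRowContraction fun w : {w : FreeMonoid ι // w.length = m} => FreeMonoid.lift T w.1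
  | 0 => by
    intro h
    have : Unique {w : FreeMonoid ι // w.length = 0} :=
      ⟨⟨⟨1, rfl⟩⟩, fun w => Subtype.ext (FreeMonoid.length_eq_zero.mp w.2)⟩
    refine le_trans (le_of_eq ?_) (isRowContraction_one (ι := {w : FreeMonoid ι // w.length = 0}) h)
    refine tsum_congr fun w => ?_
    simp only [FreeMonoid.length_eq_zero.mp w.2, map_one]
  | m + 1 => by
    let e : ι × {w : FreeMonoid ι // w.length = m} ≃ {w : FreeMonoid ι // w.length = m + 1} :=
      Equiv.ofBijective
        (fun x => ⟨FreeMonoid.of x.1 * x.2.1, by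
          rw [FreeMonoid.length_mul, FreeMonoid.length_of, x.2.2, add_comm]⟩) (by
        constructor
        · rintro ⟨i, v, hv⟩ ⟨j, w, hw⟩ h
          have h' : i :: v.toList = j :: w.toList := Subtype.ext_iff.mp h
          obtain ⟨rfl, h2⟩ := List.cons.inj h'
          obtain rfl : v = w := h2
          rfl
        · rintro ⟨w, hw⟩
          cases w using FreeMonoid.casesOn with
          | one => simp at hw
          | of_mul i v =>
            refine ⟨⟨i, v, ?_⟩, rfl⟩
            rw [FreeMonoid.length_mul, FreeMonoid.length_of] at hw
            omega)
    have h := (hT.mul (hT.lift m)).comp_equiv e.symm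
    convert h using 2 with w
    obtain ⟨x, rfl⟩ := e.surjective w
    rw [Function.comp_apply, Equiv.symm_apply_apply]
    exact map_mul (FreeMonoid.lift T) (FreeMonoid.of x.1) x.2.1

/-- Cauchy–Schwarz for a row contraction. -/
theorem IsRowContraction.norm_sum_smul_le {ι : Type*} {T : ι → (H →L[ℂ] H)}
    (hT : IsRowContraction T) (s : Finset ι) (a : ι → ℂ) :
    ‖∑ i ∈ s, a i • T i‖ ≤ Real.sqrt (∑ i ∈ s, ‖a i‖ ^ 2) := by
  rw [← LinearIsometryEquiv.norm_map adjoint, map_sum]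
  refine opNorm_le_bound _ (Real.sqrt_nonneg _) fun h => ?_
  have hs : ∑ i ∈ s, ‖adjoint (T i) h‖ ^ 2 ≤ ‖h‖ ^ 2 := by
    have := (ENNReal.sum_le_tsum s).trans (hT h)
    simp only [← ofReal_norm, ← ENNReal.ofReal_pow (norm_nonneg _)] at this
    rwa [← ENNReal.ofReal_sum_of_nonneg fun _ _ => sq_nonneg _,
      ENNReal.ofReal_le_ofReal_iff (sq_nonneg _)] at this
  rw [_root_.sum_apply]
  calc ‖∑ i ∈ s, (adjoint (a i • T i)) h‖
      ≤ ∑ i ∈ s, ‖a i‖ * ‖adjoint (T i) h‖ := by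
        refine (norm_sum_le _ _).trans (Finset.sum_le_sum fun i _ => ?_)
        rw [← star_eq_adjoint, star_smul, smul_apply, norm_smul, norm_star, star_eq_adjoint]
    _ ≤ Real.sqrt (∑ i ∈ s, ‖a i‖ ^ 2) * Real.sqrt (∑ i ∈ s, ‖adjoint (T i) h‖ ^ 2) :=
        Real.sum_mul_le_sqrt_mul_sqrt _ _ _
    _ ≤ Real.sqrt (∑ i ∈ s, ‖a i‖ ^ 2) * ‖h‖ := by
        gcongr
        exact Real.sqrt_le_iff.mpr ⟨norm_nonneg _, hs⟩

theorem isRowContraction_of_norm_le {m : ℕ} {T : Fin m → (H →L[ℂ] H)}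
    (hT : ‖∑ j, T j * adjoint (T j)‖ ≤ 1) : IsRowContraction T := fun h => by
  have key : ∑ j, ‖adjoint (T j) h‖ ^ 2 ≤ ‖h‖ ^ 2 := by
    calc ∑ j, ‖adjoint (T j) h‖ ^ 2
        = RCLike.re (inner ℂ ((∑ j, T j * adjoint (T j)) h) h) := by
          rw [_root_.sum_apply, sum_inner, map_sum]
          refine Finset.sum_congr rfl fun j _ => ?_
          rw [mul_apply_eq_comp, ← adjoint_inner_right, inner_self_eq_norm_sq]
      _ ≤ ‖(∑ j, T j * adjoint (T j)) h‖ * ‖h‖ := re_inner_le_norm _ _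
      _ ≤ 1 * ‖h‖ * ‖h‖ := by
          gcongr
          exact le_of_opNorm_le _ hT _
      _ = ‖h‖ ^ 2 := by ring
  rw [tsum_fintype]
  simp only [← ofReal_norm, ← ENNReal.ofReal_pow (norm_nonneg _)]
  rw [← ENNReal.ofReal_sum_of_nonneg fun _ _ => sq_nonneg _]
  exact ENNReal.ofReal_le_ofReal key

variable {k : ℕ} {n : Fin k → ℕ}

/-- The monomials of a fixed multi-degree are the products of the entries of `k` row contractions,
one for each word length, so they form a row contraction themselves. -/
theorem norm_multiHomPart_le_of_isRowContraction {X : OpTuple n H}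
    (hX : ∀ i, IsRowContraction (X i)) (a : MultiWord n → ℂ) (p : Fin k → ℕ) :
    ‖multiHomPart a X p‖ ≤
      Real.sqrt (∑ α ∈ (finite_multiHomWords n p).toFinset, ‖a α‖ ^ 2) := by
  have h : IsRowContraction fun α : {α : MultiWord n // ∀ i, (α i).length = p i} =>
      monomial X α.1 :=
    (IsRowContraction.prod_ofFn fun i => (hX i).lift (p i)).comp_equiv Equiv.subtypePiEquivPi
  have h' := h.norm_sum_smul_le
    (((finite_multiHomWords n p).toFinset).subtype fun α => ∀ i, (α i).length = p i)
    fun α => a α.1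
  have hmem : ∀ α ∈ (finite_multiHomWords n p).toFinset, ∀ i, (α i).length = p i :=
    fun α hα => (Set.Finite.mem_toFinset _).mp hα
  rwa [Finset.sum_subtype_of_mem (fun α => a α • monomial X α) hmem,
    Finset.sum_subtype_of_mem (fun α => ‖a α‖ ^ 2) hmem] at h'

theorem isRowContraction_of_mem_closure {X : OpTuple n H}
    (hX : X ∈ closure (regularPolyball n H)) (i : Fin k) : IsRowContraction (X i) := by
  have hc : IsClosed {X : OpTuple n H | ‖∑ j, X i j * adjoint (X i j)‖ ≤ 1} := by
    refine isClosed_le ?_ continuous_const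
    simp only [← star_eq_adjoint]
    fun_prop
  refine isRowContraction_of_norm_le (closure_minimal (fun Y hY => ?_) hc hX)
  have h : Real.sqrt ‖∑ j, Y i j * adjoint (Y i j)‖ < 1 := hY.1.1 i
  exact ((Real.sqrt_lt' one_pos).mp h).le.trans_eq (one_pow 2)

end RowContraction

/-! ### Cauchy estimates for the homogeneous parts -/

section CauchyEstimate

/-- Fourier coefficients of an absolutely convergent trigonometric series bounded by `C`: the
terms of any fixed frequency add up to a number of modulus at most `C`. -/
theorem norm_sum_le_of_norm_tsum_le {ι : Type*} [Countable ι] (d : ι → ℕ) {c : ι → ℂ}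
    (hc : Summable fun p => ‖c p‖) {C : ℝ}
    (hC : ∀ θ : ℝ, ‖∑' p, Complex.exp (θ * Complex.I) ^ d p * c p‖ ≤ C) (q : ℕ) (s : Finset ι)
    (hs : ∀ p, p ∈ s ↔ d p = q) : ‖∑ p ∈ s, c p‖ ≤ C := by
  classical
  have hnorm : ∀ (θ : ℝ) (m : ℕ), ‖Complex.exp (θ * Complex.I) ^ m‖ = 1 := fun θ m => by
    rw [norm_pow, Complex.norm_exp_ofReal_mul_I, one_pow]
  have hnorm' : ∀ θ : ℝ, ‖Complex.exp (-(q * θ) * Complex.I)‖ = 1 := fun θ => by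
    have := Complex.norm_exp_ofReal_mul_I (-(q * θ))
    push_cast at this
    exact this
  have hsum : ∀ θ : ℝ, Summable fun p => Complex.exp (θ * Complex.I) ^ d p * c p := fun θ =>
    Summable.of_norm (by simpa only [norm_mul, hnorm, one_mul] using hc)
  have hint : ∀ p, ∫ θ in (0 : ℝ)..(2 * Real.pi),
      Complex.exp (-(q * θ) * Complex.I) * (Complex.exp (θ * Complex.I) ^ d p * c p) =
      if p ∈ s then 2 * Real.pi * c p else 0 := fun p => by
    have h1 : ∀ θ : ℝ, Complex.exp (-(q * θ) * Complex.I) *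
        (Complex.exp (θ * Complex.I) ^ d p * c p) =
        Complex.exp ((((d p : ℤ) - q : ℤ) * Complex.I) * θ) * c p := fun θ => by
      rw [← mul_assoc, ← Complex.exp_nat_mul, ← Complex.exp_add]
      congr 2
      push_cast
      ring
    simp only [h1, intervalIntegral.integral_mul_const]
    split_ifs with hp
    · rw [(hs p).mp hp]
      simp
    · have hne : (((d p : ℤ) - q : ℤ) : ℂ) * Complex.I ≠ 0 := by
        refine mul_ne_zero ?_ Complex.I_ne_zero
        rw [Int.cast_ne_zero, sub_ne_zero, Ne, Nat.cast_inj]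
        exact fun h => hp ((hs p).mpr h)
      rw [integral_exp_mul_complex hne]
      have h2 : Complex.exp ((((d p : ℤ) - q : ℤ) : ℂ) * Complex.I * ((2 * Real.pi : ℝ) : ℂ)) = 1 :=
        Complex.exp_eq_one_iff.mpr ⟨(d p : ℤ) - q, by push_cast; ring⟩
      rw [h2]
      simp
  have key := intervalIntegral.hasSum_integral_of_dominated_convergence
    (μ := MeasureTheory.volume) (a := 0) (b := 2 * Real.pi)
    (F := fun p (θ : ℝ) =>
      Complex.exp (-(q * θ) * Complex.I) * (Complex.exp (θ * Complex.I) ^ d p * c p))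
    (f := fun θ => Complex.exp (-(q * θ) * Complex.I) *
      ∑' p, Complex.exp (θ * Complex.I) ^ d p * c p)
    (fun p _ => ‖c p‖)
    (fun p => (by fun_prop : Continuous fun θ : ℝ => Complex.exp (-(q * θ) * Complex.I) *
      (Complex.exp (θ * Complex.I) ^ d p * c p)).aestronglyMeasurable)
    (fun p => Filter.Eventually.of_forall fun θ _ => by
      rw [norm_mul, norm_mul, hnorm, hnorm', one_mul, one_mul])
    (Filter.Eventually.of_forall fun _ _ => hc) intervalIntegrable_const
    (Filter.Eventually.of_forall fun θ _ => (hsum θ).hasSum.mul_left _)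
  simp only [hint] at key
  have h3 := key.unique (hasSum_sum_of_ne_finset_zero (s := s) fun p hp => if_neg hp)
  have h4 : ∑ p ∈ s, (if p ∈ s then 2 * Real.pi * c p else 0) = 2 * Real.pi * ∑ p ∈ s, c p := by
    rw [Finset.mul_sum]
    exact Finset.sum_congr rfl fun p hp => if_pos hp
  have h5 := intervalIntegral.norm_integral_le_of_norm_le_const (a := 0) (b := 2 * Real.pi)
    (f := fun θ : ℝ => Complex.exp (-(q * θ) * Complex.I) *
      ∑' p, Complex.exp (θ * Complex.I) ^ d p * c p) (C := C)
    (fun θ _ => by rw [norm_mul, hnorm', one_mul]; exact hC θ)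
  rw [h3, h4, norm_mul, sub_zero, abs_of_pos Real.two_pi_pos, mul_comm] at h5
  have h6 : ‖(2 * Real.pi : ℂ)‖ = 2 * Real.pi := by
    rw [norm_mul, Complex.norm_ofNat, Complex.norm_real, Real.norm_of_nonneg Real.pi_pos.le]
  rw [h6] at h5
  exact le_of_mul_le_mul_right h5 Real.two_pi_pos

variable {k : ℕ} {n : Fin k → ℕ} {H : Type u} [NormedAddCommGroup H] [InnerProductSpace ℂ H]
  [CompleteSpace H]

theorem cpMap_smul_of_norm_eq_one {m : ℕ} {z : ℂ} (hz : ‖z‖ = 1) (T : Fin m → (H →L[ℂ] H)) :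
    cpMap (z • T) = cpMap T := by
  have h : z * star z = 1 := by
    rw [← starRingEnd_apply, Complex.mul_conj, Complex.normSq_eq_norm_sq, hz]
    simp
  refine LinearMap.ext fun Y => ?_
  change ∑ j, (z • T) j * Y * ContinuousLinearMap.adjoint ((z • T) j) =
    ∑ j, T j * Y * ContinuousLinearMap.adjoint (T j)
  refine Finset.sum_congr rfl fun j _ => ?_
  rw [Pi.smul_apply, ← ContinuousLinearMap.star_eq_adjoint, star_smul, smul_mul_assoc,
    smul_mul_smul_comm, h, one_smul, ContinuousLinearMap.star_eq_adjoint]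

/-- Regular polyballs are circular. -/
theorem smul_mem_regularPolyball {z : ℂ} (hz : ‖z‖ = 1) {X : OpTuple n H}
    (hX : X ∈ regularPolyball n H) : z • X ∈ regularPolyball n H := by
  have hcp : ∀ i, cpMap ((z • X) i) = cpMap (X i) := fun i => cpMap_smul_of_norm_eq_one hz (X i)
  have hd : defect (z • X) = defect X := by
    unfold defect
    simp only [hcp]
  obtain ⟨⟨h1, h2⟩, h3⟩ := hX
  refine ⟨⟨fun i => ?_, fun s t hst a b => ((h2 s t hst a b).smul_left z).smul_right z⟩, ?_⟩
  · have h4 : ∀ T : Fin (n i) → (H →L[ℂ] H),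
        ∑ j, T j * ContinuousLinearMap.adjoint (T j) = cpMap T 1 := fun T =>
      Finset.sum_congr rfl fun j _ => by rw [mul_one]
    have h5 : Real.sqrt ‖∑ j, X i j * ContinuousLinearMap.adjoint (X i j)‖ < 1 := h1 i
    change Real.sqrt ‖∑ j, (z • X) i j * ContinuousLinearMap.adjoint ((z • X) i j)‖ < 1
    rwa [h4, hcp, ← h4]
  · rwa [hd]

/-- Cauchy estimate: each homogeneous part of a bounded free holomorphic function is bounded on
the closed regular polyball by the supremum norm of the function. -/
theorem norm_homPart_le_supNorm {a : MultiWord n → ℂ} (ha : a ∈ hardySpace.{u} n)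
    {Y : OpTuple n H} (hY : Y ∈ closure (regularPolyball n H)) (q : ℕ) :
    ‖homPart a Y q‖ ≤ supNorm.{u} a := by
  refine closure_minimal (t := {Y : OpTuple n H | ‖homPart a Y q‖ ≤ supNorm.{u} a})
    (fun X hX => ?_) (isClosed_le (continuous_homPart a q).norm continuous_const) hY
  -- Functionals turn the unconditionally convergent expansion into an absolutely convergent one.
  refine NormedSpace.norm_le_dual_bound ℂ _ (supNorm_nonneg a) fun ψ => ?_
  rw [homPart_eq_sum_multiHomPart, map_sum]
  refine norm_sum_le_of_norm_tsum_le (fun p : Fin k → ℕ => ∑ i, p i)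
    (summable_norm_iff.mpr (ψ.summable (ha.1 H X hX))) (fun θ => ?_) q _ fun p => by simp
  have hz := smul_mem_regularPolyball (Complex.norm_exp_ofReal_mul_I θ) hX
  have h := ψ.map_tsum (ha.1 H _ hz)
  simp only [multiHomPart_smul, map_smul, smul_eq_mul] at h
  have hv := norm_eval_le_supNorm ha hz
  simp only [eval, multiHomPart_smul] at hv
  rw [← h]
  exact (ψ.le_opNorm _).trans
    ((mul_le_mul_of_nonneg_left hv (norm_nonneg _)).trans_eq (mul_comm _ _))

end CauchyEstimate

/-! ### Shifts on truncated Fock spaces -/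

section Fock

open scoped Classical

variable {k : ℕ} (n : Fin k → ℕ) (N : ℕ)

/-- The multi-words of total length at most `N`, which index an orthonormal basis of the
truncated Fock space. They are lifted to an arbitrary universe, so that the space lives there. -/
abbrev FockIndex : Type u :=
  ULift.{u} {β : MultiWord n // ∑ i, (β i).length ≤ N}

instance : Finite (FockIndex.{u} n N) := by
  have h : {β : MultiWord n | ∑ i, (β i).length ≤ N}.Finite := by
    refine ((Set.finite_le_nat N).biUnion fun q _ => finite_homWords n q).subset fun β hβ => ?_
    exact Set.mem_biUnion (x := ∑ i, (β i).length) hβ rfl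
  have := h.to_subtype
  exact inferInstanceAs (Finite (ULift.{u} ↥{β : MultiWord n | ∑ i, (β i).length ≤ N}))

instance : Fintype (FockIndex.{u} n N) := Fintype.ofFinite _

/-- The truncated Fock space. -/
abbrev Fock : Type u := EuclideanSpace ℂ (FockIndex.{u} n N)

variable {n}

/-- The basis vector of the multi-word `γ`, which is zero if the length of `γ` exceeds `N`. -/
def fockVec (γ : MultiWord n) : Fock.{u} n N :=
  WithLp.toLp 2 fun β => if β.down.1 = γ then 1 else 0

theorem fockVec_apply (γ : MultiWord n) (β : FockIndex.{u} n N) :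
    fockVec N γ β = if β.down.1 = γ then 1 else 0 :=
  rfl

theorem fockIndex_ext_iff {β γ : FockIndex.{u} n N} : β = γ ↔ β.down.1 = γ.down.1 :=
  ⟨fun h => by rw [h], fun h => ULift.ext _ _ (Subtype.ext h)⟩

/-- The matrix of the `j`-th left creation operator in the `i`-th factor, multiplied by `ρ`. -/
def shiftMatrix (ρ : ℝ) (i : Fin k) (j : Fin (n i)) :
    Matrix (FockIndex.{u} n N) (FockIndex.{u} n N) ℂ :=
  Matrix.of fun β γ => if β.down.1 = Pi.mulSingle i (FreeMonoid.of j) * γ.down.1 then ρ else 0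

theorem shiftMatrix_apply (ρ : ℝ) (i : Fin k) (j : Fin (n i)) (β γ : FockIndex.{u} n N) :
    shiftMatrix N ρ i j β γ =
      if β.down.1 = Pi.mulSingle i (FreeMonoid.of j) * γ.down.1 then (ρ : ℂ) else 0 :=
  rfl

/-- The tuple of left creation operators on the truncated Fock space, multiplied by `ρ`. -/
def fockShift (ρ : ℝ) : OpTuple n (Fock.{u} n N) :=
  fun i j => Matrix.toEuclideanCLM (𝕜 := ℂ) (shiftMatrix N ρ i j)

/-- The diagonal operator with real diagonal entries `d`. -/
def fockDiag (d : MultiWord n → ℝ) : Fock.{u} n N →L[ℂ] Fock.{u} n N :=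
  Matrix.toEuclideanCLM (𝕜 := ℂ) (Matrix.diagonal fun β => (d β.down.1 : ℂ))

theorem sum_length_mulSingle_mul (i : Fin k) (w : FreeMonoid (Fin (n i))) (γ : MultiWord n) :
    ∑ l, ((Pi.mulSingle i w * γ : MultiWord n) l).length = w.length + ∑ l, (γ l).length := by
  simp only [Pi.mul_apply, FreeMonoid.length_mul, Finset.sum_add_distrib]
  congr 1
  rw [Finset.sum_eq_single i (fun l _ hl => by rw [Pi.mulSingle_eq_of_ne hl]; rfl) (by simp),
    Pi.mulSingle_eq_same]

theorem fockShift_fockVec (ρ : ℝ) (i : Fin k) (j : Fin (n i)) (γ : MultiWord n) :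
    fockShift.{u} N ρ i j (fockVec N γ) =
      (ρ : ℂ) • fockVec N (Pi.mulSingle i (FreeMonoid.of j) * γ) := by
  ext β
  change (Matrix.mulVec (shiftMatrix N ρ i j) fun β => if β.down.1 = γ then 1 else 0) β =
    (ρ : ℂ) * if β.down.1 = Pi.mulSingle i (FreeMonoid.of j) * γ then 1 else 0
  rw [Matrix.mulVec, dotProduct]
  by_cases hγ : ∑ i, (γ i).length ≤ N
  · rw [Finset.sum_eq_single ⟨γ, hγ⟩]
    · simp [shiftMatrix_apply]
    · intro δ _ hδ
      rw [if_neg, mul_zero]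
      exact fun h => hδ ((fockIndex_ext_iff N).mpr h)
    · simp
  · rw [Finset.sum_eq_zero, if_neg, mul_zero]
    · intro h
      have h1 := β.down.2
      rw [h, sum_length_mulSingle_mul] at h1
      omega
    · intro δ _
      rw [if_neg, mul_zero]
      rintro rfl
      exact hγ δ.down.2

theorem lift_fockShift_fockVec (ρ : ℝ) (i : Fin k) (w : FreeMonoid (Fin (n i)))
    (γ : MultiWord n) :
    FreeMonoid.lift (fockShift.{u} N ρ i) w (fockVec N γ) =
      (ρ : ℂ) ^ w.length • fockVec N (Pi.mulSingle i w * γ) := by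
  induction w using FreeMonoid.inductionOn' with
  | one => simp
  | of_mul x xs ih =>
    rw [map_mul, mul_apply_eq_comp, ih, map_smul, FreeMonoid.lift_eval_of, fockShift_fockVec,
      smul_smul, ← mul_assoc, ← Pi.mulSingle_mul, FreeMonoid.length_mul, FreeMonoid.length_of,
      add_comm, pow_succ]

theorem prod_map_mulSingle {L : List (Fin k)} (hL : L.Nodup) (α : MultiWord n) (l : Fin k) :
    (L.map fun i => (Pi.mulSingle i (α i) : MultiWord n)).prod l = if l ∈ L then α l else 1 := by
  induction L with
  | nil => simp
  | cons i L ih =>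
    rw [List.nodup_cons] at hL
    rw [List.map_cons, List.prod_cons, Pi.mul_apply, ih hL.2]
    by_cases hl : l = i
    · subst hl
      simp [hL.1]
    · simp [hl]

theorem monomial_fockShift_fockVec_one (ρ : ℝ) (α : MultiWord n) :
    monomial (fockShift.{u} N ρ) α (fockVec N 1) =
      (ρ : ℂ) ^ (∑ i, (α i).length) • fockVec N α := by
  have h : ∀ L : List (Fin k),
      (L.map fun i => FreeMonoid.lift (fockShift.{u} N ρ i) (α i)).prod (fockVec N 1) =
        (ρ : ℂ) ^ (L.map fun i => (α i).length).sum •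
          fockVec N (L.map fun i => (Pi.mulSingle i (α i) : MultiWord n)).prod := fun L => by
    induction L with
    | nil => simp
    | cons i L ih =>
      rw [List.map_cons, List.prod_cons, mul_apply_eq_comp, ih, map_smul,
        lift_fockShift_fockVec, smul_smul, List.map_cons, List.sum_cons, List.map_cons,
        List.prod_cons, pow_add, mul_comm]
  unfold monomial
  rw [List.ofFn_eq_map, h, ← List.ofFn_eq_map, List.sum_ofFn]
  congr 2
  funext l
  rw [prod_map_mulSingle (List.nodup_finRange k), if_pos (List.mem_finRange l)]

theorem fock_ext {A B : Fock.{u} n N →L[ℂ] Fock.{u} n N}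
    (h : ∀ γ, A (fockVec N γ) = B (fockVec N γ)) : A = B := by
  refine ContinuousLinearMap.coe_injective ?_
  refine (EuclideanSpace.basisFun (FockIndex.{u} n N) ℂ).toBasis.ext fun β => ?_
  have hβ : (EuclideanSpace.basisFun (FockIndex.{u} n N) ℂ).toBasis β = fockVec N β.down.1 := by
    ext γ
    rw [OrthonormalBasis.coe_toBasis, EuclideanSpace.basisFun_apply, fockVec_apply,
      PiLp.single_apply]
    exact if_congr (fockIndex_ext_iff N) rfl rfl
  rw [hβ]
  exact h _

theorem commute_fockShift (ρ : ℝ) {s t : Fin k} (hst : s ≠ t) (a : Fin (n s)) (b : Fin (n t)) :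
    Commute (fockShift.{u} N ρ s a) (fockShift.{u} N ρ t b) := by
  refine fock_ext N fun γ => ?_
  rw [mul_apply_eq_comp, mul_apply_eq_comp, fockShift_fockVec, fockShift_fockVec, map_smul,
    map_smul, fockShift_fockVec, fockShift_fockVec, ← mul_assoc, ← mul_assoc]
  have h := Pi.mulSingle_commute (f := fun i => FreeMonoid (Fin (n i))) hst (FreeMonoid.of a)
    (FreeMonoid.of b)
  rw [h.eq]

theorem fockDiag_mul (d e : MultiWord n → ℝ) :
    fockDiag.{u} N d * fockDiag N e = fockDiag N (d * e) := by
  unfold fockDiag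
  rw [← map_mul, Matrix.diagonal_mul_diagonal]
  simp

theorem fockDiag_one : fockDiag.{u} N (1 : MultiWord n → ℝ) = 1 := by
  unfold fockDiag
  simp

theorem fockDiag_sub (d e : MultiWord n → ℝ) :
    fockDiag.{u} N d - fockDiag N e = fockDiag N (d - e) := by
  unfold fockDiag
  rw [← map_sub, Matrix.diagonal_sub]
  simp

theorem adjoint_fockDiag (d : MultiWord n → ℝ) :
    ContinuousLinearMap.adjoint (fockDiag.{u} N d) = fockDiag N d := by
  unfold fockDiag
  rw [← ContinuousLinearMap.star_eq_adjoint, ← map_star, Matrix.star_eq_conjTranspose,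
    Matrix.diagonal_conjTranspose]
  congr 2
  funext β
  simp

theorem isPositive_fockDiag {d : MultiWord n → ℝ} (hd : 0 ≤ d) :
    (fockDiag.{u} N d).IsPositive := by
  have h := ContinuousLinearMap.isPositive_adjoint_comp_self (fockDiag.{u} N fun β => √(d β))
  rw [adjoint_fockDiag] at h
  convert h
  refine Eq.trans ?_ (fockDiag_mul N _ _).symm
  congr 1
  funext β
  exact (Real.mul_self_sqrt (hd β)).symm

theorem isUnit_fockDiag {d : MultiWord n → ℝ} (hd : ∀ β, d β ≠ 0) : IsUnit (fockDiag.{u} N d) := by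
  refine ⟨⟨fockDiag N d, fockDiag N d⁻¹, ?_, ?_⟩, rfl⟩
  all_goals
    rw [fockDiag_mul, ← fockDiag_one]
    congr 1
    funext β
    simp [hd β]

theorem norm_fockDiag_le {d : MultiWord n → ℝ} {c : ℝ} (hc : 0 ≤ c) (hd : ∀ β, |d β| ≤ c) :
    ‖fockDiag.{u} N d‖ ≤ c := by
  open scoped Matrix.Norms.L2Operator in
  unfold fockDiag
  rw [Matrix.l2_opNorm_toEuclideanCLM, Matrix.l2_opNorm_diagonal]
  refine (pi_norm_le_iff_of_nonneg hc).mpr fun β => ?_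
  rw [Complex.norm_real]
  exact hd _

/-- The completely positive map of the `i`-th shifts multiplies a diagonal that does not depend
on the `i`-th word by `ρ ^ 2` times the projection onto the nonempty `i`-th words. -/
theorem cpMap_fockShift_fockDiag (ρ : ℝ) (i : Fin k) {d : MultiWord n → ℝ}
    (hd : ∀ j γ, d (Pi.mulSingle i (FreeMonoid.of j) * γ) = d γ) :
    cpMap (fockShift.{u} N ρ i) (fockDiag N d) =
      fockDiag N fun β => if β i = 1 then 0 else ρ ^ 2 * d β := by
  have h : cpMap (fockShift.{u} N ρ i) (fockDiag N d) = Matrix.toEuclideanCLM (𝕜 := ℂ)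
      (∑ j, shiftMatrix N ρ i j * (Matrix.diagonal fun β => (d β.down.1 : ℂ)) *
        (shiftMatrix N ρ i j).conjTranspose) := by
    rw [map_sum]
    change ∑ j, fockShift N ρ i j * fockDiag N d *
      ContinuousLinearMap.adjoint (fockShift N ρ i j) = _
    refine Finset.sum_congr rfl fun j _ => ?_
    rw [map_mul, map_mul, ← Matrix.star_eq_conjTranspose, map_star,
      ContinuousLinearMap.star_eq_adjoint]
    rfl
  rw [h, fockDiag]
  congr 1
  ext β β'
  rw [Matrix.sum_apply]
  have h0 : ∀ j, (shiftMatrix N ρ i j *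
      (Matrix.diagonal fun β : FockIndex.{u} n N => (d β.down.1 : ℂ)) *
      (shiftMatrix N ρ i j).conjTranspose) β β' =
      ∑ γ, shiftMatrix N ρ i j β γ * d γ.down.1 * star (shiftMatrix N ρ i j β' γ) := fun j => by
    rw [Matrix.mul_apply]
    simp only [Matrix.mul_diagonal, Matrix.conjTranspose_apply]
  simp only [h0]
  rcases β with ⟨β, hβ⟩
  -- Split according to whether the `i`-th word of `β` is empty.
  rcases h1 : (β i).toList with _ | ⟨j, v⟩
  · replace h1 : β i = 1 := h1
    have h2 : ∀ (j) (γ : MultiWord n), β ≠ Pi.mulSingle i (FreeMonoid.of j) * γ := by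
      intro j γ h2
      have h3 := congrArg FreeMonoid.length (h1.symm.trans (congrFun h2 i))
      rw [Pi.mul_apply, Pi.mulSingle_eq_same, FreeMonoid.length_mul, FreeMonoid.length_of,
        FreeMonoid.length_one] at h3
      omega
    rw [Finset.sum_eq_zero fun j _ => Finset.sum_eq_zero fun γ _ => by
      rw [shiftMatrix_apply, if_neg (h2 j _), zero_mul, zero_mul]]
    rw [Matrix.diagonal_apply]
    simp [h1]
  · replace h1 : β i = FreeMonoid.of j * FreeMonoid.ofList v := h1
    -- The only contribution comes from removing the first letter of the `i`-th word of `β`.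
    obtain ⟨γ, hγ⟩ : ∃ γ : MultiWord n, γ = Function.update β i (FreeMonoid.ofList v) := ⟨_, rfl⟩
    have h2 : β = Pi.mulSingle i (FreeMonoid.of j) * γ := by
      funext l
      rw [Pi.mul_apply, hγ]
      by_cases hl : l = i
      · subst hl
        rw [Pi.mulSingle_eq_same, Function.update_self, h1]
      · rw [Pi.mulSingle_eq_of_ne hl, Function.update_of_ne hl, one_mul]
    have h3 : β i ≠ 1 := by
      rw [h1]
      exact fun h => by simpa using congrArg FreeMonoid.length h
    have hγN : ∑ l, (γ l).length ≤ N := by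
      have h4 := hβ
      rw [h2, sum_length_mulSingle_mul] at h4
      omega
    rw [Finset.sum_eq_single j, Finset.sum_eq_single ⟨γ, hγN⟩]
    · rw [shiftMatrix_apply, if_pos h2, Matrix.diagonal_apply, shiftMatrix_apply]
      by_cases hβ' : β = β'.down.1
      · have h5 : (⟨⟨β, hβ⟩⟩ : FockIndex.{u} n N) = β' :=
          (fockIndex_ext_iff N).mpr hβ'
        rw [if_pos h5, if_pos (hβ'.symm.trans h2), if_neg h3,
          show d β = d γ by rw [h2, hd]]
        simp only [RCLike.star_def, Complex.conj_ofReal]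
        push_cast
        ring
      · have h5 : (⟨⟨β, hβ⟩⟩ : FockIndex.{u} n N) ≠ β' := fun h => hβ' (by rw [← h])
        rw [if_neg h5, if_neg fun h => hβ' (h2.trans h.symm), star_zero, mul_zero]
    · intro δ _ hδ
      rw [shiftMatrix_apply, if_neg, zero_mul, zero_mul]
      intro h
      exact hδ ((fockIndex_ext_iff N).mpr (mul_left_cancel (h.symm.trans h2)))
    · simp
    · intro j' _ hj
      refine Finset.sum_eq_zero fun δ _ => ?_
      rw [shiftMatrix_apply, if_neg, zero_mul, zero_mul]
      intro h
      have h6 := (congrFun h i).symm.trans h1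
      rw [Pi.mul_apply, Pi.mulSingle_eq_same] at h6
      exact hj (List.cons.inj h6).1
    · simp

/-- The scaled shifts belong to the regular polyball: their defect operator is diagonal with
entries `∏ (1 - ρ ^ 2)`, over the nonempty words of the index. -/
theorem fockShift_mem_regularPolyball {ρ : ℝ} (h0 : 0 ≤ ρ) (h1 : ρ < 1) :
    fockShift.{u} N ρ ∈ regularPolyball n (Fock.{u} n N) := by
  have hρ : ρ ^ 2 < 1 := pow_lt_one₀ h0 h1 two_ne_zero
  have hd : defect (fockShift.{u} N ρ) 1 = fockDiag N fun β : MultiWord n =>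
      ((List.finRange k).map fun i => if β i = 1 then 1 else 1 - ρ ^ 2).prod := by
    unfold defect
    rw [List.ofFn_eq_map]
    have key : ∀ L : List (Fin k), L.Nodup →
        (L.map fun i => 1 - cpMap (fockShift.{u} N ρ i)).prod 1 = fockDiag N fun β : MultiWord n =>
          (L.map fun i => if β i = 1 then 1 else 1 - ρ ^ 2).prod := by
      intro L hL
      induction L with
      | nil => exact (fockDiag_one N).symm
      | cons i L ih =>
        rw [List.nodup_cons] at hL
        rw [List.map_cons, List.prod_cons, Module.End.mul_apply, ih hL.2, LinearMap.sub_apply,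
          Module.End.one_apply, cpMap_fockShift_fockDiag, fockDiag_sub]
        · congr 1
          funext β
          rw [Pi.sub_apply, List.map_cons, List.prod_cons]
          split_ifs <;> ring
        · intro j γ
          congr 1
          refine List.map_congr_left fun l hl => ?_
          have hli : l ≠ i := fun h => hL.1 (h ▸ hl)
          rw [Pi.mul_apply, Pi.mulSingle_eq_of_ne hli, one_mul]
    exact key _ (List.nodup_finRange k)
  have hpos : ∀ β : MultiWord n,
      0 < ((List.finRange k).map fun i => if β i = 1 then 1 else 1 - ρ ^ 2).prod := fun β => by
    refine List.prod_pos fun x hx => ?_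
    obtain ⟨i, _, rfl⟩ := List.mem_map.mp hx
    split_ifs <;> linarith
  refine ⟨⟨fun i => ?_, fun s t hst a b => commute_fockShift N ρ hst a b⟩, ?_, ?_⟩
  · change √‖∑ j, fockShift.{u} N ρ i j * ContinuousLinearMap.adjoint (fockShift.{u} N ρ i j)‖ < 1
    have h2 : ∑ j, fockShift.{u} N ρ i j * ContinuousLinearMap.adjoint (fockShift.{u} N ρ i j) =
        cpMap (fockShift.{u} N ρ i) (fockDiag N (1 : MultiWord n → ℝ)) := by
      rw [fockDiag_one]
      exact Finset.sum_congr rfl fun j _ => by rw [mul_one]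
    rw [h2, cpMap_fockShift_fockDiag N ρ i fun _ _ => rfl, Real.sqrt_lt' one_pos, one_pow]
    refine (norm_fockDiag_le N (sq_nonneg ρ) fun β => ?_).trans_lt hρ
    split_ifs
    · rw [abs_zero]
      positivity
    · rw [Pi.one_apply, mul_one, abs_of_nonneg (sq_nonneg ρ)]
  · rw [hd]
    exact isPositive_fockDiag N fun β => (hpos β).le
  · rw [hd]
    exact isUnit_fockDiag N fun β => (hpos β).ne'

theorem norm_fockVec_one : ‖fockVec.{u} N (1 : MultiWord n)‖ = 1 := by
  have h : fockVec.{u} N (1 : MultiWord n) =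
      EuclideanSpace.single (⟨⟨1, by simp⟩⟩ : FockIndex.{u} n N) 1 := by
    ext β
    rw [fockVec_apply, PiLp.single_apply]
    exact if_congr (fockIndex_ext_iff N (γ := ⟨⟨1, by simp⟩⟩)).symm rfl rfl
  rw [h, PiLp.norm_single, norm_one]

/-- Applied to the vacuum vector, the value at the scaled shifts displays the coefficients. -/
theorem eval_fockShift_fockVec_one {a : MultiWord n → ℂ} {ρ : ℝ}
    (ha : Summable (multiHomPart a (fockShift.{u} N ρ))) (β : FockIndex.{u} n N) :
    eval a (fockShift.{u} N ρ) (fockVec N 1) β =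
      a β.down.1 * (ρ : ℂ) ^ (∑ i, (β.down.1 i).length) := by
  let ψ : (Fock.{u} n N →L[ℂ] Fock.{u} n N) →L[ℂ] ℂ :=
    (EuclideanSpace.proj β).comp (ContinuousLinearMap.apply ℂ _ (fockVec N 1))
  have hψ : ∀ p, ψ (multiHomPart a (fockShift.{u} N ρ) p) =
      ∑ α ∈ (finite_multiHomWords n p).toFinset, if β.down.1 = α then
        a β.down.1 * (ρ : ℂ) ^ (∑ i, (β.down.1 i).length) else 0 := fun p => by
    rw [multiHomPart, map_sum]
    refine Finset.sum_congr rfl fun α _ => ?_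
    change (a α • monomial (fockShift.{u} N ρ) α (fockVec N 1)) β = _
    rw [monomial_fockShift_fockVec_one]
    change a α * ((ρ : ℂ) ^ (∑ i, (α i).length) * if β.down.1 = α then 1 else 0) = _
    split_ifs with h
    · rw [h, mul_one]
    · rw [mul_zero, mul_zero]
  change ψ (eval a (fockShift.{u} N ρ)) = _
  rw [eval, ψ.map_tsum ha, tsum_eq_single fun i => (β.down.1 i).length]
  · rw [hψ, Finset.sum_ite_eq, if_pos]
    exact (Set.Finite.mem_toFinset _).mpr fun i => rfl
  · intro p hp
    rw [hψ, Finset.sum_ite_eq, if_neg]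
    intro h
    exact hp (funext fun i => ((finite_multiHomWords n p).mem_toFinset.mp h i).symm)

/-- The coefficients of a bounded free holomorphic function are square summable, with
`ℓ²`-norm at most the supremum norm. -/
theorem sum_sq_coeff_le_supNorm_sq {a : MultiWord n → ℂ} (ha : a ∈ hardySpace.{u} n)
    (s : Finset (MultiWord n)) : ∑ α ∈ s, ‖a α‖ ^ 2 ≤ supNorm.{u} a ^ 2 := by
  obtain ⟨N, hN⟩ : ∃ N, ∀ α ∈ s, ∑ i, (α i).length ≤ N :=
    ⟨s.sup fun α => ∑ i, (α i).length, fun α hα => Finset.le_sup (f := fun α : MultiWord n =>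
      ∑ i, (α i).length) hα⟩
  have key : ∀ ρ : ℝ, 0 ≤ ρ → ρ < 1 →
      ∑ α ∈ s, ‖a α‖ ^ 2 * (ρ ^ (∑ i, (α i).length)) ^ 2 ≤ supNorm.{u} a ^ 2 := by
    intro ρ h0 h1
    have hX := fockShift_mem_regularPolyball.{u} (n := n) N h0 h1
    have h2 := (ContinuousLinearMap.le_opNorm _ (fockVec N 1)).trans
      (mul_le_mul_of_nonneg_right (norm_eval_le_supNorm ha hX) (norm_nonneg _))
    rw [norm_fockVec_one, mul_one] at h2
    refine le_trans ?_ (pow_le_pow_left₀ (norm_nonneg _) h2 2)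
    rw [EuclideanSpace.norm_sq_eq]
    simp only [eval_fockShift_fockVec_one N (ha.1 _ _ hX), norm_mul, norm_pow, Complex.norm_real,
      Real.norm_of_nonneg h0, mul_pow]
    calc ∑ α ∈ s, ‖a α‖ ^ 2 * (ρ ^ (∑ i, (α i).length)) ^ 2
        = ∑ β : FockIndex.{u} n N with β.down.1 ∈ s,
            ‖a β.down.1‖ ^ 2 * (ρ ^ (∑ i, (β.down.1 i).length)) ^ 2 := by
          refine (Finset.sum_nbij (fun β : FockIndex.{u} n N => β.down.1)
            (fun β hβ => (mem_filter.mp hβ).2)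
            (fun β _ γ _ h => (fockIndex_ext_iff N).mpr h) (fun α hα => ?_) fun _ _ => rfl).symm
          exact ⟨⟨⟨α, hN α hα⟩⟩, mem_coe.mpr (mem_filter.mpr ⟨mem_univ _, hα⟩), rfl⟩
      _ ≤ _ := Finset.sum_le_univ_sum_of_nonneg fun β => by positivity
  have hlim : Filter.Tendsto
      (fun ρ : ℝ => ∑ α ∈ s, ‖a α‖ ^ 2 * (ρ ^ (∑ i, (α i).length)) ^ 2)
      (nhdsWithin 1 (Set.Iio 1)) (nhds (∑ α ∈ s, ‖a α‖ ^ 2)) := by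
    have hc : Continuous fun ρ : ℝ => ∑ α ∈ s, ‖a α‖ ^ 2 * (ρ ^ (∑ i, (α i).length)) ^ 2 := by
      fun_prop
    have := hc.tendsto 1
    simp only [one_pow, mul_one] at this
    exact this.mono_left nhdsWithin_le_nhds
  refine le_of_tendsto hlim ?_
  filter_upwards [Ioo_mem_nhdsLT (zero_lt_one' ℝ)] with ρ hρ
  exact key ρ hρ.1.le hρ.2

end Fock

/-! ### Lower bounds -/

section LowerBounds

variable {k : ℕ} {n : Fin k → ℕ}

/-- The geometric series `∑ r ^ (2 |p|)` over all nonzero multi-indices has the sum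
`(1 - r ^ 2)⁻ᵏ - 1 = 1`, which bounds its partial sums. -/
theorem sum_sq_pow_le_one {r : ℝ} (hr : r ^ 2 < 1) (hk : (1 - r ^ 2) ^ k = 1 / 2)
    {F : Finset (Fin k → ℕ)} (hF : 0 ∉ F) : ∑ p ∈ F, (r ^ ∑ i, p i) ^ 2 ≤ 1 := by
  classical
  obtain ⟨N, hN⟩ : ∃ N, ∀ p ∈ insert 0 F, ∀ i, p i ≤ N :=
    ⟨(insert 0 F).sup fun p => ∑ i, p i, fun p hp i =>
      (Finset.single_le_sum (f := p) (fun _ _ => Nat.zero_le _) (mem_univ i)).trans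
        (Finset.le_sup (f := fun p : Fin k → ℕ => ∑ i, p i) hp)⟩
  have h1 : ∑ p ∈ insert 0 F, (r ^ ∑ i, p i) ^ 2 ≤ 2 := by
    calc ∑ p ∈ insert 0 F, (r ^ ∑ i, p i) ^ 2
        ≤ ∑ p ∈ Fintype.piFinset fun _ : Fin k => range (N + 1), (r ^ ∑ i, p i) ^ 2 := by
          refine Finset.sum_le_sum_of_subset_of_nonneg (fun p hp => ?_) fun _ _ _ => sq_nonneg _
          rw [Fintype.mem_piFinset]
          exact fun i => mem_range.mpr (Nat.lt_succ_of_le (hN p hp i))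
      _ = ∏ _i : Fin k, ∑ m ∈ range (N + 1), (r ^ 2) ^ m := by
          rw [Finset.prod_univ_sum]
          refine Finset.sum_congr rfl fun p _ => ?_
          rw [Finset.prod_pow_eq_pow_sum, ← pow_mul, ← pow_mul, mul_comm]
      _ ≤ ∏ _i : Fin k, (1 - r ^ 2)⁻¹ := by
          refine Finset.prod_le_prod (fun _ _ => by positivity) fun _ _ => ?_
          rw [← tsum_geometric_of_lt_one (sq_nonneg r) hr]
          exact (summable_geometric_of_lt_one (sq_nonneg r) hr).sum_le_tsum _
            fun _ _ => by positivity
      _ = 2 := by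
          rw [Finset.prod_const, Finset.card_univ, Fintype.card_fin, inv_pow, hk]
          norm_num
  rw [Finset.sum_insert hF] at h1
  simp only [Pi.zero_apply, Finset.sum_const_zero, pow_zero, one_pow] at h1
  linarith

theorem multiHomPart_zero_index_eq_zero {a : MultiWord n → ℂ} (ha : a ∈ hardySpaceZero.{u} n)
    {H : Type u} [NormedAddCommGroup H] [InnerProductSpace ℂ H] (X : OpTuple n H) :
    multiHomPart a X 0 = 0 := by
  rw [multiHomPart_zero_index, coeff_one_eq_zero ha, zero_smul]

theorem sum_sum_sq_coeff_le {a : MultiWord n → ℂ} (ha : a ∈ hardySpace.{u} n)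
    (F : Finset (Fin k → ℕ)) :
    ∑ p ∈ F, ∑ α ∈ (finite_multiHomWords n p).toFinset, ‖a α‖ ^ 2 ≤ supNorm.{u} a ^ 2 := by
  classical
  rw [← Finset.sum_biUnion]
  · exact sum_sq_coeff_le_supNorm_sq ha _
  · intro p _ q _ hpq
    refine Finset.disjoint_left.mpr fun α hp hq => hpq (funext fun i => ?_)
    exact ((finite_multiHomWords n p).mem_toFinset.mp hp i).symm.trans
      ((finite_multiHomWords n q).mem_toFinset.mp hq i)

/-- Every `r` with `(1 - r ^ 2) ^ k = 1 / 2` is a multi-homogeneous Bohr radius: the norm of the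
part of multi-degree `p` is at most `r ^ |p|` times the `ℓ²`-norm of its coefficients, and the
Cauchy–Schwarz inequality over `p ≠ 0` applies. -/
theorem mem_bohrSetMultiHomZero {r : ℝ} (h0 : 0 ≤ r) (hr : r ^ 2 < 1)
    (hk : (1 - r ^ 2) ^ k = 1 / 2) : r ∈ bohrSetMultiHomZero.{u} n := by
  classical
  refine ⟨h0, fun a ha H _ _ _ Y hY => ?_⟩
  rw [ENNReal.tsum_eq_iSup_sum]
  refine iSup_le fun F => ?_
  simp only [← ofReal_norm]
  rw [← ENNReal.ofReal_sum_of_nonneg fun _ _ => norm_nonneg _]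
  refine ENNReal.ofReal_le_ofReal ?_
  have h1 : ∑ p ∈ F, ‖multiHomPart a ((r : ℂ) • Y) p‖ =
      ∑ p ∈ F.erase 0, ‖multiHomPart a ((r : ℂ) • Y) p‖ :=
    (Finset.sum_erase _ (by rw [multiHomPart_zero_index_eq_zero ha, norm_zero])).symm
  rw [h1]
  set A : (Fin k → ℕ) → ℝ := fun p =>
    √(∑ α ∈ (finite_multiHomWords n p).toFinset, ‖a α‖ ^ 2) with hA
  have hA2 : ∑ p ∈ F.erase 0, A p ^ 2 ≤ supNorm.{u} a ^ 2 := by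
    refine le_trans (le_of_eq ?_) (sum_sum_sq_coeff_le ha.1 (F.erase 0))
    exact Finset.sum_congr rfl fun p _ =>
      Real.sq_sqrt (Finset.sum_nonneg fun _ _ => sq_nonneg _)
  calc ∑ p ∈ F.erase 0, ‖multiHomPart a ((r : ℂ) • Y) p‖
      ≤ ∑ p ∈ F.erase 0, r ^ (∑ i, p i) * A p := by
        refine Finset.sum_le_sum fun p _ => ?_
        rw [multiHomPart_smul, norm_smul, norm_pow, Complex.norm_real, Real.norm_of_nonneg h0]
        exact mul_le_mul_of_nonneg_left (norm_multiHomPart_le_of_isRowContraction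
          (isRowContraction_of_mem_closure hY) a p) (pow_nonneg h0 _)
    _ ≤ √(∑ p ∈ F.erase 0, (r ^ ∑ i, p i) ^ 2) * √(∑ p ∈ F.erase 0, A p ^ 2) :=
        Real.sum_mul_le_sqrt_mul_sqrt _ _ _
    _ ≤ 1 * supNorm.{u} a := by
        gcongr
        · exact Real.sqrt_le_one.mpr (sum_sq_pow_le_one hr hk (Finset.notMem_erase _ _))
        · exact Real.sqrt_le_iff.mpr ⟨supNorm_nonneg a, hA2⟩
    _ = supNorm.{u} a := one_mul _

theorem sqrt_mem_bohrSetMultiHomZero (hk : 1 ≤ k) :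
    √(1 - (1 / 2 : ℝ) ^ (1 / (k : ℝ))) ∈ bohrSetMultiHomZero.{u} n := by
  have h1 : (1 / 2 : ℝ) ^ (1 / (k : ℝ)) ≤ 1 :=
    Real.rpow_le_one (by norm_num) (by norm_num) (by positivity)
  have h2 : 0 < (1 / 2 : ℝ) ^ (1 / (k : ℝ)) := by positivity
  have h3 : √(1 - (1 / 2 : ℝ) ^ (1 / (k : ℝ))) ^ 2 = 1 - (1 / 2 : ℝ) ^ (1 / (k : ℝ)) :=
    Real.sq_sqrt (by linarith)
  refine mem_bohrSetMultiHomZero (Real.sqrt_nonneg _) (by linarith) ?_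
  rw [h3, sub_sub_cancel, one_div (k : ℝ), Real.rpow_inv_natCast_pow (by norm_num) (by omega)]

/-- Cauchy estimates and a vanishing constant term give `∑_{q ≥ 1} 2 ^ (-q) = 1`. -/
theorem one_half_mem_bohrSetHomZero : (1 / 2 : ℝ) ∈ bohrSetHomZero.{u} n := by
  refine ⟨one_half_pos.le, fun a ha H _ _ _ Y hY => ?_⟩
  have h0 : homPart a Y 0 = 0 := by
    rw [homPart_eq_sum_multiHomPart, Finset.piAntidiag_zero, Finset.sum_singleton,
      multiHomPart_zero_index_eq_zero ha]
  have hle : ∀ q, ‖homPart a (((1 / 2 : ℝ) : ℂ) • Y) (q + 1)‖ₑ ≤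
      ENNReal.ofReal (supNorm.{u} a / 2 / 2 ^ q) := fun q => by
    rw [← ofReal_norm]
    refine ENNReal.ofReal_le_ofReal ?_
    rw [homPart_smul, norm_smul, norm_pow, Complex.norm_real, Real.norm_of_nonneg (by norm_num)]
    refine (mul_le_mul_of_nonneg_left (norm_homPart_le_supNorm ha.1 hY (q + 1))
      (by positivity)).trans_eq ?_
    rw [pow_succ, one_div_pow]
    ring
  have hs := hasSum_geometric_two' (supNorm.{u} a)
  rw [tsum_eq_zero_add' ENNReal.summable, homPart_smul, h0, smul_zero, enorm_zero, zero_add]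
  refine (ENNReal.tsum_le_tsum hle).trans_eq ?_
  have := supNorm_nonneg.{u} a
  rw [← ENNReal.ofReal_tsum_of_nonneg (fun _ => by positivity) hs.summable, hs.tsum_eq]

end LowerBounds

/-! ### Series in a single entry -/

section SingleEntry

variable {k : ℕ} {n : Fin k → ℕ}

/-- The coefficients, as a free power series, of the power series `∑ c_m Z_{i,j} ^ m` in the single
variable `Z_{i,j}`. -/
def singleEntryCoeff (i : Fin k) (j : Fin (n i)) (c : ℕ → ℂ) (α : MultiWord n) : ℂ :=
  open Classical in
  if α = Pi.mulSingle i (FreeMonoid.of j ^ (α i).length) then c (α i).length else 0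

theorem length_of_pow {ι : Type*} (j : ι) (m : ℕ) : (FreeMonoid.of j ^ m).length = m := by
  induction m with
  | zero => rfl
  | succ m ih => rw [pow_succ, FreeMonoid.length_mul, ih, FreeMonoid.length_of]

theorem singleEntryCoeff_mulSingle (i : Fin k) (j : Fin (n i)) (c : ℕ → ℂ) (m : ℕ) :
    singleEntryCoeff (n := n) i j c (Pi.mulSingle i (FreeMonoid.of j ^ m)) = c m := by
  rw [singleEntryCoeff, Pi.mulSingle_eq_same, length_of_pow, if_pos rfl]

section

variable {H : Type u} [NormedAddCommGroup H] [InnerProductSpace ℂ H]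

theorem monomial_mulSingle (X : OpTuple n H) (i : Fin k) (j : Fin (n i)) (m : ℕ) :
    monomial X (Pi.mulSingle i (FreeMonoid.of j ^ m)) = X i j ^ m := by
  unfold monomial
  rw [List.ofFn_eq_map, List.prod_map_eq_pow_single i,
    List.count_eq_one_of_mem (List.nodup_finRange k) (List.mem_finRange i), pow_one,
    Pi.mulSingle_eq_same, map_pow, FreeMonoid.lift_eval_of]
  intro l hl _
  rw [Pi.mulSingle_eq_of_ne hl, map_one]

theorem multiHomPart_singleEntryCoeff (i : Fin k) (j : Fin (n i)) (c : ℕ → ℂ) (X : OpTuple n H)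
    (m : ℕ) : multiHomPart (singleEntryCoeff i j c) X (Pi.single i m) = c m • X i j ^ m := by
  unfold multiHomPart
  rw [Finset.sum_eq_single (Pi.mulSingle i (FreeMonoid.of j ^ m)),
    singleEntryCoeff_mulSingle, monomial_mulSingle]
  · intro α hα hne
    have h : (α i).length = m := by
      rw [(finite_multiHomWords n _).mem_toFinset.mp hα i, Pi.single_eq_same]
    rw [singleEntryCoeff, h, if_neg hne, zero_smul]
  · intro h
    refine absurd ((finite_multiHomWords n _).mem_toFinset.mpr fun l => ?_) h
    by_cases hl : l = i
    · subst hl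
      rw [Pi.mulSingle_eq_same, Pi.single_eq_same, length_of_pow]
    · rw [Pi.mulSingle_eq_of_ne hl, Pi.single_eq_of_ne hl]
      rfl

theorem multiHomPart_singleEntryCoeff_eq_zero (i : Fin k) (j : Fin (n i)) (c : ℕ → ℂ)
    (X : OpTuple n H) {p : Fin k → ℕ} (hp : p ∉ Set.range (Pi.single i)) :
    multiHomPart (singleEntryCoeff i j c) X p = 0 := by
  refine Finset.sum_eq_zero fun α hα => ?_
  have h := (finite_multiHomWords n _).mem_toFinset.mp hα
  rw [singleEntryCoeff, if_neg, zero_smul]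
  intro hα'
  refine hp ⟨p i, funext fun l => ?_⟩
  by_cases hl : l = i
  · subst hl
    rw [Pi.single_eq_same]
  · rw [← h l, hα', Pi.mulSingle_eq_of_ne hl, Pi.single_eq_of_ne hl]
    rfl

theorem homPart_singleEntryCoeff (i : Fin k) (j : Fin (n i)) (c : ℕ → ℂ) (X : OpTuple n H)
    (q : ℕ) : homPart (singleEntryCoeff i j c) X q = c q • X i j ^ q := by
  rw [homPart_eq_sum_multiHomPart, Finset.sum_eq_single (Pi.single i q),
    multiHomPart_singleEntryCoeff]
  · intro p hp hne
    refine multiHomPart_singleEntryCoeff_eq_zero i j c X ?_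
    rintro ⟨m, rfl⟩
    have h : m = q := by simpa using hp
    exact hne (by rw [h])
  · intro h
    simp at h

theorem hasSum_multiHomPart_singleEntryCoeff {i : Fin k} {j : Fin (n i)} {c : ℕ → ℂ}
    {X : OpTuple n H} {S : H →L[ℂ] H} (h : HasSum (fun m => c m • X i j ^ m) S) :
    HasSum (multiHomPart (singleEntryCoeff i j c) X) S := by
  rw [← (Pi.single_injective (M := fun _ : Fin k => ℕ) i).hasSum_iff fun p hp =>
    multiHomPart_singleEntryCoeff_eq_zero i j c X hp]
  convert h using 2 with m
  exact multiHomPart_singleEntryCoeff i j c X m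

end

variable {H : Type u} [NormedAddCommGroup H] [InnerProductSpace ℂ H] [CompleteSpace H]

theorem norm_entry_le_one {X : OpTuple n H} (hX : X ∈ regularPolyball n H) (i : Fin k)
    (j : Fin (n i)) : ‖X i j‖ ≤ 1 := by
  simpa using (isRowContraction_of_mem_closure (subset_closure hX) i).norm_sum_smul_le {j}
    fun _ => 1

/-- Scalar tuples whose rows have Euclidean norm less than one belong to the regular polyball. -/
theorem scalar_mem_regularPolyball (x : (i : Fin k) → Fin (n i) → ℂ)
    (hx : ∀ i, ∑ j, ‖x i j‖ ^ 2 < 1) :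
    (fun i j => x i j • (1 : H →L[ℂ] H)) ∈ regularPolyball n H := by
  have hmul : ∀ (z : ℂ) (Y : H →L[ℂ] H),
      z • (1 : H →L[ℂ] H) * Y * ContinuousLinearMap.adjoint (z • (1 : H →L[ℂ] H)) =
        ((‖z‖ ^ 2 : ℝ) : ℂ) • Y := fun z Y => by
    rw [← ContinuousLinearMap.star_eq_adjoint, star_smul, star_one, smul_mul_assoc, one_mul,
      smul_mul_smul_comm, mul_one, ← starRingEnd_apply, Complex.mul_conj,
      Complex.normSq_eq_norm_sq]
  have hcp : ∀ i, cpMap (fun j => x i j • (1 : H →L[ℂ] H)) =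
      algebraMap ℂ (Module.End ℂ (H →L[ℂ] H)) ((∑ j, ‖x i j‖ ^ 2 : ℝ) : ℂ) := fun i => by
    refine LinearMap.ext fun Y => ?_
    change ∑ j, x i j • (1 : H →L[ℂ] H) * Y *
      ContinuousLinearMap.adjoint (x i j • (1 : H →L[ℂ] H)) = _
    simp only [hmul]
    rw [← Finset.sum_smul, Module.algebraMap_end_apply, Complex.ofReal_sum]
  have hd : defect (fun i j => x i j • (1 : H →L[ℂ] H)) 1 =
      ((∏ i, (1 - ∑ j, ‖x i j‖ ^ 2) : ℝ) : ℂ) • (1 : H →L[ℂ] H) := by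
    have h : ∀ i, 1 - cpMap (fun j => x i j • (1 : H →L[ℂ] H)) =
        algebraMap ℂ (Module.End ℂ (H →L[ℂ] H)) ((1 - ∑ j, ‖x i j‖ ^ 2 : ℝ) : ℂ) := fun i => by
      rw [hcp, Complex.ofReal_sub, map_sub, Complex.ofReal_one, map_one]
    unfold defect
    simp only [h]
    rw [List.ofFn_comp' (fun i => ((1 - ∑ j, ‖x i j‖ ^ 2 : ℝ) : ℂ)) (algebraMap ℂ _),
      ← map_list_prod, List.prod_ofFn, Module.algebraMap_end_apply, Complex.ofReal_prod]
  have hpos : 0 < ∏ i, (1 - ∑ j, ‖x i j‖ ^ 2) :=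
    Finset.prod_pos fun i _ => sub_pos.mpr (hx i)
  refine ⟨⟨fun i => ?_, fun s t _ a b => ?_⟩, ?_, ?_⟩
  · change √‖∑ j, x i j • (1 : H →L[ℂ] H) *
      ContinuousLinearMap.adjoint (x i j • (1 : H →L[ℂ] H))‖ < 1
    have h : ∑ j, x i j • (1 : H →L[ℂ] H) * ContinuousLinearMap.adjoint (x i j • (1 : H →L[ℂ] H)) =
        ((∑ j, ‖x i j‖ ^ 2 : ℝ) : ℂ) • (1 : H →L[ℂ] H) := by
      rw [Complex.ofReal_sum, Finset.sum_smul]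
      exact Finset.sum_congr rfl fun j _ => by rw [← hmul, mul_one]
    have h0 : 0 ≤ ∑ j, ‖x i j‖ ^ 2 := Finset.sum_nonneg fun _ _ => sq_nonneg _
    rw [h, Real.sqrt_lt' one_pos, one_pow, norm_smul, Complex.norm_real, Real.norm_of_nonneg h0]
    exact (mul_le_of_le_one_right h0 ContinuousLinearMap.norm_id_le).trans_lt (hx i)
  · exact ((Commute.one_left (1 : H →L[ℂ] H)).smul_left _).smul_right _
  · rw [hd]
    exact ContinuousLinearMap.isPositive_one.smul_of_nonneg (by exact_mod_cast hpos.le)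
  · rw [hd]
    exact isUnit_one.smul (Units.mk0 _ (Complex.ofReal_ne_zero.mpr hpos.ne'))

end SingleEntry

/-! ### The extremal Möbius function -/

section Moebius

/-- The Taylor coefficients of `z (b - z) / (1 - b z)`. -/
def moebiusCoeff (b : ℝ) : ℕ → ℝ
  | 0 => 0
  | 1 => b
  | m + 2 => -((1 - b ^ 2) * b ^ m)

variable {H : Type u} [NormedAddCommGroup H] [InnerProductSpace ℂ H] [CompleteSpace H]

/-- The von Neumann inequality for `z (b - z) / (1 - b z)`. -/
theorem exists_hasSum_moebiusCoeff {b : ℝ} (h0 : 0 ≤ b) (h1 : b < 1) {T : H →L[ℂ] H}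
    (hT : ‖T‖ ≤ 1) :
    ∃ F : H →L[ℂ] H, HasSum (fun m => (moebiusCoeff b m : ℂ) • T ^ m) F ∧ ‖F‖ ≤ 1 := by
  have hbT : ‖(b : ℂ) • T‖ < 1 := by
    rw [norm_smul, Complex.norm_real, Real.norm_of_nonneg h0]
    exact (mul_le_of_le_one_right h0 hT).trans_lt h1
  set S : H →L[ℂ] H := ∑' m : ℕ, ((b : ℂ) • T) ^ m with hS
  have hSsum : HasSum (fun m : ℕ => ((b : ℂ) • T) ^ m) S :=
    (summable_geometric_of_norm_lt_one hbT).hasSum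
  have hinv : (1 - (b : ℂ) • T) * S = 1 := mul_neg_geom_series _ hbT
  set G : H →L[ℂ] H := (b : ℂ) • 1 - ((1 - b ^ 2 : ℝ) : ℂ) • (T * S) with hG
  refine ⟨T * G, ?_, ?_⟩
  · rw [← hasSum_nat_add_iff' 2]
    have h2 := ((hSsum.mul_left (T * T)).const_smul (-((1 - b ^ 2 : ℝ) : ℂ)))
    have h3 : ∀ m, (moebiusCoeff b (m + 2) : ℂ) • T ^ (m + 2) =
        -((1 - b ^ 2 : ℝ) : ℂ) • (T * T * ((b : ℂ) • T) ^ m) := fun m => by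
      rw [smul_pow, mul_smul_comm, smul_smul, ← pow_two, ← pow_add, add_comm 2 m]
      congr 1
      simp only [moebiusCoeff]
      push_cast
      ring
    have h4 : T * G - ∑ m ∈ range 2, (moebiusCoeff b m : ℂ) • T ^ m =
        -((1 - b ^ 2 : ℝ) : ℂ) • (T * T * S) := by
      rw [Finset.sum_range_succ, Finset.sum_range_one, hG, mul_sub, mul_smul_comm, mul_smul_comm,
        mul_one, pow_one, neg_smul, mul_assoc]
      simp [moebiusCoeff]
    simp only [h3]
    rw [h4]
    exact h2
  · have hGn : ‖G‖ ≤ 1 := by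
      refine ContinuousLinearMap.opNorm_le_bound _ zero_le_one fun h => ?_
      obtain ⟨v, hv⟩ : ∃ v, v = S h := ⟨_, rfl⟩
      -- With `h = (1 - b T) v` the inequality is `‖(b - T) v‖ ≤ ‖(1 - b T) v‖`.
      have hh : h = v - (b : ℂ) • T v := by
        have := congrArg (fun A : H →L[ℂ] H => A h) hinv
        rw [hv]
        exact this.symm
      have hGh : G h = (b : ℂ) • v - T v := by
        have : G h = (b : ℂ) • h - ((1 - b ^ 2 : ℝ) : ℂ) • T v := by rw [hv]; rfl
        rw [this, hh]
        push_cast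
        module
      rw [hGh, one_mul, hh]
      refine le_of_sq_le_sq ?_ (norm_nonneg _)
      have hTv : ‖T v‖ ≤ ‖v‖ := (T.le_of_opNorm_le hT v).trans_eq (one_mul _)
      have hTv2 : ‖T v‖ ^ 2 ≤ ‖v‖ ^ 2 := pow_le_pow_left₀ (norm_nonneg _) hTv 2
      rw [@norm_sub_sq ℂ, @norm_sub_sq ℂ, inner_smul_left, inner_smul_right, norm_smul, norm_smul,
        Complex.conj_ofReal, Complex.norm_real, Real.norm_of_nonneg h0, mul_pow, mul_pow]
      nlinarith [pow_lt_one₀ h0 h1 two_ne_zero]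
    exact (norm_mul_le _ _).trans (mul_le_one₀ hT (norm_nonneg _) hGn)

theorem hasSum_abs_moebiusCoeff {b t : ℝ} (h0 : 0 ≤ b) (h1 : b < 1) (ht0 : 0 ≤ t) (ht : t ≤ 1) :
    HasSum (fun m => |moebiusCoeff b m| * t ^ m)
      (b * t + (1 - b ^ 2) * t ^ 2 * (1 - b * t)⁻¹) := by
  have hb2 : b ^ 2 < 1 := pow_lt_one₀ h0 h1 two_ne_zero
  rw [← hasSum_nat_add_iff' 2]
  have h2 := (hasSum_geometric_of_lt_one (mul_nonneg h0 ht0)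
    ((mul_le_of_le_one_right h0 ht).trans_lt h1)).mul_left ((1 - b ^ 2) * t ^ 2)
  have h3 : ∀ m, |moebiusCoeff b (m + 2)| * t ^ (m + 2) =
      (1 - b ^ 2) * t ^ 2 * (b * t) ^ m := fun m => by
    have h4 : 0 ≤ (1 - b ^ 2) * b ^ m := mul_nonneg (by linarith) (pow_nonneg h0 m)
    simp only [moebiusCoeff, abs_neg, abs_of_nonneg h4]
    ring
  have h5 : b * t + (1 - b ^ 2) * t ^ 2 * (1 - b * t)⁻¹ -
      ∑ m ∈ range 2, |moebiusCoeff b m| * t ^ m = (1 - b ^ 2) * t ^ 2 * (1 - b * t)⁻¹ := by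
    rw [Finset.sum_range_succ, Finset.sum_range_one]
    simp [moebiusCoeff, abs_of_nonneg h0]
  simp only [h3]
  rw [h5]
  exact h2

end Moebius

/-! ### Upper bounds -/

section UpperBound

variable {k : ℕ} {n : Fin k → ℕ}

theorem singleEntryCoeff_moebiusCoeff_mem {b : ℝ} (h0 : 0 ≤ b) (h1 : b < 1) (i : Fin k)
    (j : Fin (n i)) :
    singleEntryCoeff i j (fun m => (moebiusCoeff b m : ℂ)) ∈ hardySpaceZero.{u} n ∧
      supNorm.{u} (singleEntryCoeff (n := n) i j fun m => (moebiusCoeff b m : ℂ)) ≤ 1 := by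
  have hbound : ∀ x ∈ valueNorms.{u}
      (singleEntryCoeff (n := n) i j fun m => (moebiusCoeff b m : ℂ)), x ≤ 1 := by
    rintro _ ⟨H, _, _, _, X, hX, rfl⟩
    obtain ⟨F, hF, hF1⟩ := exists_hasSum_moebiusCoeff h0 h1 (norm_entry_le_one hX i j)
    rwa [eval, (hasSum_multiHomPart_singleEntryCoeff hF).tsum_eq]
  refine ⟨⟨⟨fun H _ _ _ X hX => ?_, 1, hbound⟩, fun H _ _ _ => ?_⟩,
    Real.sSup_le hbound zero_le_one⟩
  · obtain ⟨F, hF, -⟩ := exists_hasSum_moebiusCoeff h0 h1 (norm_entry_le_one hX i j)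
    exact (hasSum_multiHomPart_singleEntryCoeff hF).summable
  · have h := singleEntryCoeff_mulSingle (n := n) i j (fun m => (moebiusCoeff b m : ℂ)) 0
    rw [pow_zero, Pi.mulSingle_one] at h
    rw [eval_zero, h]
    simp [moebiusCoeff]

/-- For `b = 1 / √2`, the Möbius function `z (b - z) / (1 - b z)` of a single entry violates the
Bohr inequality at every radius larger than `1 / √2`. -/
theorem le_of_mem_bohrSetHomZero (hk : 1 ≤ k) (hn : ∀ i, 1 ≤ n i) {r : ℝ}
    (hr : r ∈ bohrSetHomZero.{u} n) : r ≤ 1 / √2 := by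
  by_contra! hlt
  obtain ⟨b, hb⟩ : ∃ b, b = 1 / √2 := ⟨_, rfl⟩
  have hb2 : b ^ 2 = 1 / 2 := by
    rw [hb, div_pow, Real.sq_sqrt zero_le_two, one_pow]
  have hb0 : 0 < b := by rw [hb]; positivity
  have hb1 : b < 1 := by nlinarith
  rw [← hb] at hlt
  obtain ⟨t, hbt, ht⟩ := exists_between (lt_min hlt hb1)
  obtain ⟨htr, ht1⟩ := lt_min_iff.mp ht
  have ht0 : 0 < t := hb0.trans hbt
  have hr0 : 0 < r := ht0.trans htr
  let i : Fin k := ⟨0, hk⟩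
  let j : Fin (n i) := ⟨0, hn i⟩
  obtain ⟨ha, hsup⟩ := singleEntryCoeff_moebiusCoeff_mem.{u} (n := n) hb0.le hb1 i j
  let x : (i : Fin k) → Fin (n i) → ℂ := Pi.single i (Pi.single j ((t / r : ℝ) : ℂ))
  have htr1 : t / r < 1 := (div_lt_one hr0).mpr htr
  have hx : ∀ l, ∑ m, ‖x l m‖ ^ 2 < 1 := fun l => by
    by_cases hl : l = i
    · subst hl
      rw [Finset.sum_eq_single j]
      · simp only [x, Pi.single_eq_same]
        rw [Complex.norm_real, Real.norm_of_nonneg (by positivity)]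
        exact pow_lt_one₀ (by positivity) htr1 two_ne_zero
      · intro m _ hm
        simp [x, hm]
      · simp
    · simp [x, hl]
  have key := hr.2 _ ha (EuclideanSpace ℂ PUnit.{u + 1}) _
    (subset_closure (scalar_mem_regularPolyball x hx))
  have hnorm : ∀ q, ‖homPart (singleEntryCoeff i j fun m => (moebiusCoeff b m : ℂ))
      ((r : ℂ) • fun i j =>
        x i j • (1 : EuclideanSpace ℂ PUnit.{u + 1} →L[ℂ] EuclideanSpace ℂ PUnit.{u + 1})) q‖ₑ =
      ENNReal.ofReal (|moebiusCoeff b q| * t ^ q) := fun q => by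
    rw [homPart_singleEntryCoeff, ← ofReal_norm]
    congr 1
    have h : ((r : ℂ) • fun i j => x i j •
        (1 : EuclideanSpace ℂ PUnit.{u + 1} →L[ℂ] EuclideanSpace ℂ PUnit.{u + 1})) i j =
        (t : ℂ) • 1 := by
      simp only [Pi.smul_apply, x, Pi.single_eq_same, smul_smul]
      congr 1
      rw [← Complex.ofReal_mul, mul_div_cancel₀ _ hr0.ne']
    rw [h, smul_pow, one_pow, norm_smul, norm_smul, norm_one, mul_one, norm_pow,
      Complex.norm_real, Complex.norm_real, Real.norm_of_nonneg ht0.le, Real.norm_eq_abs]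
  simp only [hnorm] at key
  have hs := hasSum_abs_moebiusCoeff hb0.le hb1 ht0.le ht1.le
  rw [← ENNReal.ofReal_tsum_of_nonneg (fun _ => by positivity) hs.summable, hs.tsum_eq] at key
  have h1 := (ENNReal.ofReal_le_ofReal_iff zero_le_one).mp
    (key.trans (ENNReal.ofReal_le_ofReal hsup))
  -- Since `b ^ 2 = 1 / 2`, the sum equals `b t / (1 - b t)`, and `b t > 1 / 2`.
  have h2 : 1 / 2 < b * t := by nlinarith
  have h3 : 0 < 1 - b * t := by nlinarith
  have h4 : (1 - b ^ 2) * t ^ 2 = (b * t) ^ 2 := by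
    rw [mul_pow, hb2]
    ring
  rw [h4, ← div_eq_mul_inv, ← le_sub_iff_add_le', div_le_iff₀ h3] at h1
  nlinarith

end UpperBound

end Polyball

end

theorem mainTheorem12 (k : ℕ) (hk : 1 ≤ k) (n : Fin k → ℕ) (hn : ∀ i, 1 ≤ n i) :
    (IsGreatest (Polyball.bohrSetMultiHomZero.{u} n) (Polyball.bohrRadiusMultiHomZero.{u} n) ∧
      Real.sqrt (1 - (1 / 2 : ℝ) ^ (1 / (k : ℝ))) ≤ Polyball.bohrRadiusMultiHomZero.{u} n ∧
      Polyball.bohrRadiusMultiHomZero.{u} n ≤ 1 / Real.sqrt 2) ∧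
    (IsGreatest (Polyball.bohrSetHomZero.{u} n) (Polyball.bohrRadiusHomZero.{u} n) ∧
      max (1 / 2) (Real.sqrt (1 - (1 / 2 : ℝ) ^ (1 / (k : ℝ)))) ≤
        Polyball.bohrRadiusHomZero.{u} n ∧
      Polyball.bohrRadiusHomZero.{u} n ≤ 1 / Real.sqrt 2) := by
  have hmem := Polyball.sqrt_mem_bohrSetMultiHomZero.{u} (n := n) hk
  have hsub := Polyball.bohrSetMultiHomZero_subset_bohrSetHomZero.{u} (n := n)
  have hub : ∀ r ∈ Polyball.bohrSetHomZero.{u} n, r ≤ 1 / Real.sqrt 2 := fun r hr =>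
    Polyball.le_of_mem_bohrSetHomZero hk hn hr
  have hbdd : BddAbove (Polyball.bohrSetHomZero.{u} n) := ⟨_, hub⟩
  have hbdd' : BddAbove (Polyball.bohrSetMultiHomZero.{u} n) := hbdd.mono hsub
  refine ⟨⟨⟨?_, fun r hr => le_csSup hbdd' hr⟩, le_csSup hbdd' hmem,
      csSup_le ⟨_, hmem⟩ fun r hr => hub r (hsub hr)⟩,
    ⟨⟨?_, fun r hr => le_csSup hbdd hr⟩, max_le ?_ (le_csSup hbdd (hsub hmem)),
      csSup_le ⟨_, hsub hmem⟩ hub⟩⟩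
  · exact Polyball.isClosed_bohrSetMultiHomZero.csSup_mem ⟨_, hmem⟩ hbdd'
  · exact Polyball.isClosed_bohrSetHomZero.csSup_mem ⟨_, hsub hmem⟩ hbdd
  · exact le_csSup hbdd Polyball.one_half_mem_bohrSetHomZero
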